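/- Let $S=\{\lambda_n\}_{n\ge 1}$ be a sequence of non-zero complex numbers with $|\lambda_1|\le|\lambda_2|\le\cdots\to\infty$ and finite exponent of convergence $\mathsf e=\limsup_{n}\frac{\log n}{\log|\lambda_n|}<\infty$, let the genus $\mathsf g$ be the least integer $p\ge 0$ such that $\sum_n\lambda_n^{-p-1}$ converges absolutely, and let $$\log\Gamma(-\lambda,S)=-\sum_{n}\Big(\log\big(1-\tfrac{\lambda}{\lambda_n}\big)+\sum_{j=1}^{\mathsf g}\tfrac{(-1)^j}{j}\tfrac{(-\lambda)^j}{\lambda_n^j}\Big)$$ be the logarithm, vanishing at $\lambda=0$, of the reciprocal of the canonical product of $S$. Suppose that $S$ is a totally regular sequence of spectral type, that is: for some $c>0$, $0<\theta<\pi$, $S$ lies in the interior of the sector $\Sigma=\{z:|\arg(z-c)|\le\theta/2\}$, and there are an $N\in\{0,1,2,\dots\}\cup\{\infty\}$, real exponents $\alpha_0>\alpha_1>\cdots$ (indexed by $j\le N$; with $\alpha_j\to-\infty$ if $N=\infty$) and coefficients $a_{\alpha_j,0},a_{\alpha_j,1}\in\mathbb C$ (possibly zero), with $a_{\alpha_j,1}=0$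 unless $\alpha_j\in\{0,1,2,\dots\}$, such that for every finite $M\le N$ $$R_M(\lambda):=\log\Gamma(-\lambda,S)-\sum_{j=0}^{M}\big(a_{\alpha_j,0}(-\lambda)^{\alpha_j}+a_{\alpha_j,1}(-\lambda)^{\alpha_j}\log(-\lambda)\big)=o(|\lambda|^{\alpha_M})$$ as $\lambda\to\infty$, uniformly in $\mathbb C\setminus\Sigma$. Let $\alpha_N$ denote the order of $S$ ($-\infty$ if $N=\infty$). Let $\sigma$ be one of the following: (i) $\sigma=\alpha_N$; (ii) $\sigma=\alpha_N-\varepsilon$, where $N<\infty$, $\varepsilon>0$, and the last remainder satisfies $R_N(\lambda)=O(|\lambda|^{\alpha_N-\varepsilon})$ as $\lambda\to\infty$ in $\mathbb C\setminus\Sigma$. Then the zeta function $\zeta(s,S)=\sum_n\lambda_n^{-s}$ (a convergent series for $\Re s>\mathsf e$, with principal powers) has a meromorphic continuation to the half-plane $\Re s>\sigma$. It is analytic there except for at most simple poles at those of the points $s=\alpha_j$, $j\le N$, that satisfy $\alpha_j>\sigma$ (in case (ii) these are all of $\alpha_0,\dots,\alpha_N$). Write $\operatorname{Res}_1$ for the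 residue and $\operatorname{Res}_0$ for the finite part (the constant term of the Laurent expansion) of $\zeta(s,S)$ at a point. For every $j\le N$ with $\alpha_j>\sigma$: 1. if $\alpha_j$ is not an integer $\le\mathsf g$, then $\operatorname{Res}_1=\dfrac{a_{\alpha_j,0}}{\Gamma(\alpha_j)\Gamma(-\alpha_j)}$ (with $1/\Gamma=0$ at the poles of $\Gamma$); 2. if $\alpha_j\in\{1,\dots,\mathsf g\}$, then $\operatorname{Res}_1=(-1)^{\alpha_j+1}\alpha_j a_{\alpha_j,1}$ and $\operatorname{Res}_0=(-1)^{\alpha_j+1}(\alpha_j a_{\alpha_j,0}+a_{\alpha_j,1})$; 3. if $\alpha_j=0$, then $\operatorname{Res}_1=0$ and $\operatorname{Res}_0=-a_{0,1}$; 4. if $\alpha_j\in\{-1,-2,\dots\}$, then $\operatorname{Res}_1=0$ and $\operatorname{Res}_0=(-1)^{\alpha_j+1}\alpha_j a_{\alpha_j,0}$. -/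

import Mathlib

open Filter Topology Asymptotics

noncomputable section

namespace SpectralSeq

/-- The closed sector with vertex `c` and opening angle `θ` around the positive real direction.
(`Complex.arg 0 = 0`, so the vertex belongs to it.) -/
def sector (θ c : ℝ) : Set ℂ := {z : ℂ | |Complex.arg (z - c)| ≤ θ / 2}

/-- The asymptotic domain: the open complement of the sector. -/
def asymptoticDomain (θ c : ℝ) : Set ℂ := (sector θ c)ᶜ

/-- The exponent of convergence `limsup log n / log |λ_n|`; the term `λ_{n+1}` is `S n`. -/
def exponent (S : ℕ → ℂ) : EReal :=
  limsup (fun n : ℕ => ((Real.log ((n : ℝ) + 1) / Real.log ‖S n‖ : ℝ) : EReal)) atTop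

/-- The genus: the least `p` such that `∑ λ_n ^ (-p-1)` converges absolutely. -/
def genus (S : ℕ → ℂ) : ℕ :=
  sInf {p : ℕ | Summable fun n : ℕ => (‖S n‖ ^ (p + 1))⁻¹}

/-- The Weierstrass canonical product `p(z, S)`. -/
def canonicalProduct (S : ℕ → ℂ) (z : ℂ) : ℂ :=
  ∏' n : ℕ, (1 + z / S n) *
    Complex.exp (∑ j ∈ Finset.Icc 1 (genus S), (-1) ^ j / (j : ℂ) * (z ^ j / S n ^ j))

/-- The Gamma function `Γ(z, S) = 1 / p(z, S)` of the sequence. -/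
def gamma (S : ℕ → ℂ) (z : ℂ) : ℂ := (canonicalProduct S z)⁻¹

/-- `log Γ(z, S)`, as the sum of the principal logarithms of the factors. For a sequence contained
in the interior of a sector `sector θ c` with `0 < c` and `θ < π`, and `-z` in the complement of
the sector (a domain star-shaped about `0`), no `1 + z / λ_n` is a non-positive real, so this is
the analytic branch of the logarithm of `Γ(z, S)` that vanishes at `z = 0`; see
`exp_logGamma`. -/
def logGamma (S : ℕ → ℂ) (z : ℂ) : ℂ :=
  -∑' n : ℕ, (Complex.log (1 + z / S n) +
    ∑ j ∈ Finset.Icc 1 (genus S), (-1) ^ j / (j : ℂ) * (z ^ j / S n ^ j))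

theorem summable_logGamma_terms (S : ℕ → ℂ) (hS : Tendsto (fun n => ‖S n‖) atTop atTop)
    (p : ℕ) (hp : Summable fun n : ℕ => (‖S n‖ ^ (p + 1))⁻¹) (z : ℂ) :
    Summable fun n : ℕ => Complex.log (1 + z / S n) +
      ∑ j ∈ Finset.Icc 1 p, (-1) ^ j / (j : ℂ) * (z ^ j / S n ^ j) := by
  have key : ∀ w : ℂ, ∑ j ∈ Finset.Icc 1 p, (-1) ^ j / (j : ℂ) * w ^ j
      = -Complex.logTaylor (p + 1) w := by
    intro w
    rw [Complex.logTaylor, Finset.range_eq_Ico, Finset.sum_eq_sum_Ico_succ_bot (by omega)]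
    simp only [Nat.cast_zero, div_zero, zero_add]
    rw [← Finset.sum_neg_distrib]
    refine Finset.sum_congr (by ext; simp) fun j _ => ?_
    rw [pow_succ]
    ring
  have h1 : ∀ n, Complex.log (1 + z / S n) +
      ∑ j ∈ Finset.Icc 1 p, (-1) ^ j / (j : ℂ) * (z ^ j / S n ^ j)
      = Complex.log (1 + z / S n) - Complex.logTaylor (p + 1) (z / S n) := by
    intro n
    simp only [← div_pow, key]
    ring
  simp only [h1]
  refine Summable.of_norm_bounded_eventually (g := fun n => (2 * ‖z‖ ^ (p + 1)) *
    (‖S n‖ ^ (p + 1))⁻¹) (hp.mul_left _) ?_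
  rw [Nat.cofinite_eq_atTop]
  filter_upwards [hS.eventually_ge_atTop (2 * ‖z‖ + 1)] with n hn
  have hpos : 0 < ‖S n‖ := by linarith [norm_nonneg z]
  have hw : ‖z / S n‖ ≤ 1 / 2 := by
    rw [norm_div, div_le_iff₀ hpos]
    linarith
  have hlt : ‖z / S n‖ < 1 := by linarith
  refine (Complex.norm_log_sub_logTaylor_le p hlt).trans ?_
  have hinv : (1 - ‖z / S n‖)⁻¹ ≤ 2 := by
    rw [inv_le_comm₀ (by linarith) (by norm_num)]
    linarith
  have hden : (1 : ℝ) ≤ (p : ℝ) + 1 := by linarith [(Nat.cast_nonneg p : (0 : ℝ) ≤ p)]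
  calc ‖z / S n‖ ^ (p + 1) * (1 - ‖z / S n‖)⁻¹ / ((p : ℝ) + 1)
      ≤ ‖z / S n‖ ^ (p + 1) * (1 - ‖z / S n‖)⁻¹ :=
        div_le_self (mul_nonneg (by positivity) (inv_nonneg.2 (by linarith))) hden
    _ ≤ ‖z / S n‖ ^ (p + 1) * 2 := by gcongr
    _ = (2 * ‖z‖ ^ (p + 1)) * (‖S n‖ ^ (p + 1))⁻¹ := by
        rw [norm_div, div_pow]; ring

/-- `logGamma` is a logarithm of `gamma` off the zeros of the canonical product. -/
theorem exp_logGamma (S : ℕ → ℂ) (hne : ∀ n, S n ≠ 0)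
    (hS : Tendsto (fun n => ‖S n‖) atTop atTop)
    (hg : Summable fun n : ℕ => (‖S n‖ ^ (genus S + 1))⁻¹) (z : ℂ) (hz : ∀ n, z ≠ -S n) :
    Complex.exp (logGamma S z) = gamma S z := by
  have h := summable_logGamma_terms S hS (genus S) hg z
  rw [logGamma, Complex.exp_neg, gamma, canonicalProduct]
  congr 1
  rw [← (h.hasSum.cexp).tprod_eq]
  refine tprod_congr fun n => ?_
  have h0 : 1 + z / S n ≠ 0 := by
    intro h0
    refine hz n ?_
    have := hne n
    field_simp at h0
    linear_combination h0
  simp [Complex.exp_add, Complex.exp_log h0]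

/-- The filter of `λ → ∞` in the asymptotic domain. -/
def atInfinity (θ c : ℝ) : Filter ℂ := Bornology.cobounded ℂ ⊓ 𝓟 (asymptoticDomain θ c)

/-- The remainder of `log Γ(-λ, S)` after the terms
`a_{α_j,k} (-λ) ^ α_j log ^ k (-λ)`, `j = 0, …, M`; here `a_{α_j,k}` is `a j k`, and for each `j`
only finitely many of these coefficients are nonzero. -/
def remainder (S : ℕ → ℂ) (α : ℕ → ℝ) (a : ℕ → ℕ →₀ ℂ) (M : ℕ) (l : ℂ) : ℂ :=
  logGamma S (-l) - ∑ j ∈ Finset.range (M + 1),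
    (a j).sum fun k b => b * (-l) ^ (α j : ℂ) * Complex.log (-l) ^ k

/-- The order of an expansion with exponents `α_0 > … > α_N`: `α_N` if `N` is finite, `-∞` if
`N = ∞`. -/
def order (N : ℕ∞) (α : ℕ → ℝ) : EReal := if N = ⊤ then ⊥ else ((α N.toNat : ℝ) : EReal)

/-- `S` is a sequence of spectral type with sector `sector θ c`, and `log Γ(-λ, S)` has the
expansion with exponents `α j` and coefficients `a j k`, `j ≤ N ≤ ∞`. Values of `α` and `a` at
indices `j > N` play no role. -/
structure IsSpectralType (S : ℕ → ℂ) (θ c : ℝ) (N : ℕ∞) (α : ℕ → ℝ) (a : ℕ → ℕ →₀ ℂ) :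
    Prop where
  ne_zero : ∀ n, S n ≠ 0
  monotone_norm : Monotone fun n => ‖S n‖
  tendsto_norm : Tendsto (fun n => ‖S n‖) atTop atTop
  exponent_lt_top : exponent S < ⊤
  c_pos : 0 < c
  θ_pos : 0 < θ
  θ_lt_pi : θ < Real.pi
  mem_sector : ∀ n, S n ∈ interior (sector θ c)
  /-- the exponents decrease strictly -/
  exponents_lt : ∀ i j : ℕ, i < j → (j : ℕ∞) ≤ N → α j < α i
  /-- in the case of infinite order, the exponents decrease to `-∞` -/
  exponents_atBot : N = ⊤ → Tendsto α atTop atBot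
  expansion : ∀ M : ℕ, (M : ℕ∞) ≤ N →
    remainder S α a M =o[atInfinity θ c] fun l : ℂ => ‖l‖ ^ α M

/-- Regular: no power of the logarithm but the zeroth and the first occurs. -/
structure IsRegular (S : ℕ → ℂ) (θ c : ℝ) (N : ℕ∞) (α : ℕ → ℝ) (a : ℕ → ℕ →₀ ℂ) : Prop
    extends IsSpectralType S θ c N α a where
  coeff_eq_zero : ∀ j : ℕ, (j : ℕ∞) ≤ N → ∀ k : ℕ, k ≠ 0 → k ≠ 1 → a j k = 0

/-- Totally regular: moreover, the logarithmic terms that occur are of the form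
`(-λ) ^ m log (-λ)` with an integer `m ≥ 0`. -/
structure IsTotallyRegular (S : ℕ → ℂ) (θ c : ℝ) (N : ℕ∞) (α : ℕ → ℝ) (a : ℕ → ℕ →₀ ℂ) : Prop
    extends IsRegular S θ c N α a where
  exponent_of_log : ∀ j : ℕ, (j : ℕ∞) ≤ N → a j 1 ≠ 0 → ∃ m : ℕ, α j = m

/-- Near `p` the function `f` is analytic or has a simple pole, with residue `r` and finite part
(constant term of the Laurent expansion) `b`. -/
def HasResidueAndFinitePart (f : ℂ → ℂ) (p r b : ℂ) : Prop :=
  ∃ h : ℂ → ℂ, AnalyticAt ℂ h p ∧ h p = b ∧ ∀ᶠ s in 𝓝[≠] p, f s = r / (s - p) + h s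

end SpectralSeq

end

/-! The proof is a Mellin transform argument on the positive half-line. All `λ_n` have positive real
part, and `log Γ(x, S)` is minus the sum over `n` of `logKernel g (x / λ_n)`, where `g` is the
genus. Write `e` for the exponent of convergence. For `p < Re s < p + 1` one kernel of degree `p`
has `∫ x^(-s-1) logKernel p (x / w) dx = w^(-s) π / (s sin πs)` (`mellin_logKernel_div`). Summing
over `w = λ_n` gives, for `e < Re s < p + 1`, that the transform of the regularized `log Γ` at `-s`
is `-ζ(s) π / (s sin πs)` (`mellin_regLogGamma`). So `ζ` is `sineFactor` times this transform, and
it suffices to continue the latter to the left.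

The integral is split at `x = 1`. The part over `(0, 1]` is analytic for `Re s < p + 1`. Over `(1,
∞)` the expansion along the ray `λ = -x` is inserted: a term `(c₀ + c₁ log x) x^β` contributes
`c₀/(s-β) + c₁/(s-β)²` (`hasMellin_tail_powLog`), and a remainder `O(x^β)` contributes a function
analytic for `Re s > β`. The sine factor vanishes at every integer and lowers the pole order there
by one; this yields the residues and finite parts (`hasResidue_sineFactor_mul_int`,
`hasResidue_sineFactor_mul`).

Two points need care. If `e = g + 1`, no strip is left for degree `g`; then degree `g + 1` is used,
at the cost of a term `κ x^(g+1)` whose pole the sine cancels (`IsSpectralType.exists_isRegDegree`).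
And the growth of `log Γ` forces the coefficients at exponents above `e`, and the logarithmic ones
at exponents `≥ g + 1`, to vanish (`IsTotallyRegular.coeffs_of_isBigO`). -/

noncomputable section

namespace SpectralSeq

open MeasureTheory Set

/-! ### The logarithmic kernel and its bounds on the right half-plane -/

/-- The logarithm `log (1 + u)` minus its Taylor polynomial of degree `p`. -/
def logKernel (p : ℕ) (u : ℂ) : ℂ := Complex.log (1 + u) - Complex.logTaylor (p + 1) u

theorem one_add_mem_slitPlane {u : ℂ} (hu : 0 ≤ u.re) : 1 + u ∈ Complex.slitPlane :=
  Or.inl (by simp; linarith)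

theorem hasDerivAt_logKernel (p : ℕ) {u : ℂ} (hu : 0 ≤ u.re) :
    HasDerivAt (logKernel p) ((-u) ^ p * (1 + u)⁻¹) u :=
  Complex.hasDerivAt_log_sub_logTaylor p (one_add_mem_slitPlane hu)

theorem one_le_norm_one_add {u : ℂ} (hu : 0 ≤ u.re) : 1 ≤ ‖1 + u‖ := by
  have := Complex.re_le_norm (1 + u)
  simp at this
  linarith

theorem norm_le_norm_one_add {u : ℂ} (hu : 0 ≤ u.re) : ‖u‖ ≤ ‖1 + u‖ := by
  rw [← abs_of_nonneg (norm_nonneg u), ← abs_of_nonneg (norm_nonneg (1 + u)), ← sq_le_sq,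
    Complex.sq_norm, Complex.sq_norm, Complex.normSq_apply, Complex.normSq_apply]
  simp
  nlinarith

theorem norm_rpow_le_norm_one_add {u : ℂ} (hu : 0 ≤ u.re) {t : ℝ} (h0 : 0 ≤ t) (h1 : t ≤ 1) :
    ‖u‖ ^ t ≤ ‖1 + u‖ := by
  calc ‖u‖ ^ t ≤ ‖1 + u‖ ^ t :=
        Real.rpow_le_rpow (norm_nonneg _) (norm_le_norm_one_add hu) h0
    _ ≤ ‖1 + u‖ ^ (1 : ℝ) := Real.rpow_le_rpow_of_exponent_le (one_le_norm_one_add hu) h1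
    _ = ‖1 + u‖ := Real.rpow_one _

theorem logKernel_eq_integral (p : ℕ) {u : ℂ} (hu : 0 ≤ u.re) :
    logKernel p u = u * ∫ t in (0 : ℝ)..1, (-(t * u)) ^ p * (1 + t * u)⁻¹ := by
  set g : ℂ → ℂ := fun z => (-z) ^ p * (1 + z)⁻¹ with hg
  have hre : ∀ t ∈ Icc (0 : ℝ) 1, 0 ≤ ((t : ℂ) * u).re := fun t ht => by
    simpa using mul_nonneg ht.1 hu
  have hderiv : ∀ t ∈ Icc (0 : ℝ) 1,
      HasDerivAt (logKernel p) (g (0 + t • u)) (0 + t • u) := by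
    intro t ht
    rw [zero_add, Complex.real_smul]
    exact hasDerivAt_logKernel p (hre t ht)
  have hcont : ContinuousOn (fun t : ℝ => g (0 + t • u)) (Icc (0 : ℝ) 1) := by
    simp only [zero_add, hg]
    exact (Continuous.continuousOn (by fun_prop)).mul <|
      Complex.continuousOn_one_add_mul_inv (one_add_mem_slitPlane hu)
  have h := intervalIntegral.integral_unitInterval_deriv_eq_sub hcont hderiv
  have h0 : logKernel p 0 = 0 := by simp [logKernel, Complex.logTaylor_at_zero]
  simp only [zero_add, h0, sub_zero, smul_eq_mul] at h
  rw [← h]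
  simp only [hg, Complex.real_smul]

/-- Interpolating between the lower bounds `1` and `‖tu‖` for `‖1 + tu‖` gives `‖1 + tu‖ ≥
‖tu‖^(p+1-q)`, so the integrand of `logKernel_eq_integral` is at most `‖tu‖^(q-1)`. The freedom in
`q` matters: `q = p + 1` serves near `0`, and a `q` slightly above `p` serves at infinity. -/
theorem norm_logKernel_le (p : ℕ) {q : ℝ} (hq : (p : ℝ) < q) (hq' : q ≤ p + 1) {u : ℂ}
    (hu : 0 ≤ u.re) : ‖logKernel p u‖ ≤ ‖u‖ ^ q / q := by
  have hq0 : 0 < q := (Nat.cast_nonneg p).trans_lt hq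
  rcases eq_or_ne u 0 with rfl | hu0
  · simp [logKernel, Complex.logTaylor_at_zero, Real.zero_rpow hq0.ne']
  have hn : 0 < ‖u‖ := norm_pos_iff.2 hu0
  rw [logKernel_eq_integral p hu, norm_mul]
  have key : ‖∫ t in (0 : ℝ)..1, (-((t : ℂ) * u)) ^ p * (1 + t * u)⁻¹‖
      ≤ ∫ t in (0 : ℝ)..1, ‖u‖ ^ (q - 1) * t ^ (q - 1) := by
    refine intervalIntegral.norm_integral_le_of_norm_le zero_le_one ?_
      ((intervalIntegral.intervalIntegrable_rpow' (by linarith)).const_mul _)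
    filter_upwards with t ht
    have htn : ‖(t : ℂ) * u‖ = t * ‖u‖ := by simp [abs_of_pos ht.1]
    have hpos : 0 < t * ‖u‖ := mul_pos ht.1 hn
    have h1 := norm_rpow_le_norm_one_add (u := (t : ℂ) * u)
      (by simpa using mul_nonneg ht.1.le hu) (t := p + 1 - q) (by linarith) (by linarith)
    rw [htn] at h1
    rw [norm_mul, norm_pow, norm_neg, htn, norm_inv]
    calc (t * ‖u‖) ^ p * ‖1 + (t : ℂ) * u‖⁻¹
        ≤ (t * ‖u‖) ^ p * ((t * ‖u‖) ^ (p + 1 - q))⁻¹ := by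
          gcongr
      _ = (t * ‖u‖) ^ (q - 1) := by
          rw [← Real.rpow_natCast, ← Real.rpow_neg hpos.le, ← Real.rpow_add hpos]
          congr 1
          ring
      _ = ‖u‖ ^ (q - 1) * t ^ (q - 1) := by
          rw [Real.mul_rpow ht.1.le hn.le, mul_comm]
  refine (mul_le_mul_of_nonneg_left key hn.le).trans (le_of_eq ?_)
  rw [intervalIntegral.integral_const_mul, integral_rpow (Or.inl (by linarith)),
    Real.rpow_sub hn, Real.rpow_one]
  have hq2 : q - 1 + 1 = q := by ring
  rw [hq2, Real.one_rpow, Real.zero_rpow hq0.ne']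
  field_simp
  ring

/-! ### The beta integral and the Mellin transform of `1 / (x + w)` -/

theorem integrableOn_rpow_mul_inv_one_add {r : ℝ} (h0 : 0 < r) (h1 : r < 1) :
    IntegrableOn (fun x : ℝ => x ^ (r - 1) * (1 + x)⁻¹) (Ioi 0) := by
  refine mellin_convergent_of_isBigO_scalar (a := 1) (b := 0) (f := fun x : ℝ => (1 + x)⁻¹) ?_ ?_
    h1 ?_ h0
  · refine ContinuousOn.locallyIntegrableOn (fun x hx => ?_) measurableSet_Ioi
    have : (1 + x) ≠ 0 := by have := mem_Ioi.1 hx; positivity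
    exact ContinuousAt.continuousWithinAt (by fun_prop (disch := assumption))
  · refine IsBigO.of_bound 1 ?_
    filter_upwards [eventually_gt_atTop 0] with x hx
    rw [Real.rpow_neg_one, Real.norm_of_nonneg (by positivity), Real.norm_of_nonneg (by positivity),
      one_mul]
    gcongr
    linarith
  · refine IsBigO.of_bound 1 ?_
    filter_upwards [self_mem_nhdsWithin] with x hx
    have hx : 0 < x := hx
    rw [Real.norm_of_nonneg (by positivity)]
    simp
    rw [inv_le_one₀ (by positivity)]
    linarith

theorem norm_ofReal_cpow {x : ℝ} (hx : 0 < x) (z : ℂ) : ‖(x : ℂ) ^ z‖ = x ^ z.re := by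
  exact Complex.norm_cpow_eq_rpow_re_of_pos hx z

theorem continuousOn_ofReal_cpow (z : ℂ) : ContinuousOn (fun x : ℝ => (x : ℂ) ^ z) (Ioi 0) :=
  fun x hx => (Complex.continuousAt_ofReal_cpow_const x z (Or.inr (ne_of_gt hx))).continuousWithinAt

/-- Fubini for `x^(z-1) e^(-(1+x)t)`: integrating in `t` first gives the left side, integrating in
`x` first gives `Γ(z) Γ(1-z)`, and the reflection formula concludes. -/
theorem integral_cpow_div_one_add {z : ℂ} (h0 : 0 < z.re) (h1 : z.re < 1) :
    ∫ x in Ioi (0 : ℝ), (x : ℂ) ^ (z - 1) * (1 + x : ℂ)⁻¹ = Real.pi / Complex.sin (Real.pi * z) := by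
  have hexp : ∀ x ∈ Ioi (0 : ℝ), ∫ t in Ioi (0 : ℝ), (x : ℂ) ^ (z - 1) *
      Complex.exp (-((1 + x : ℝ) * t)) = (x : ℂ) ^ (z - 1) * (1 + x : ℂ)⁻¹ := by
    intro x hx
    have hx' : (0 : ℝ) < 1 + x := by have := mem_Ioi.1 hx; positivity
    have := Complex.integral_cpow_mul_exp_neg_mul_Ioi (a := 1) (r := 1 + x) (by simp) hx'
    simp only [sub_self, Complex.cpow_zero, one_mul, Complex.cpow_one, Complex.Gamma_one,
      mul_one, one_div] at this
    rw [integral_const_mul, this]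
    push_cast
    rfl
  have hgam : ∀ t ∈ Ioi (0 : ℝ), ∫ x in Ioi (0 : ℝ), (x : ℂ) ^ (z - 1) *
      Complex.exp (-((1 + x : ℝ) * t)) =
      Complex.Gamma z * ((t : ℂ) ^ ((1 - z) - 1) * Complex.exp (-((1 : ℝ) * t))) := by
    intro t ht
    have := Complex.integral_cpow_mul_exp_neg_mul_Ioi (a := z) (r := t) h0 ht
    have h2 : ∀ x : ℝ, (x : ℂ) ^ (z - 1) * Complex.exp (-((1 + x : ℝ) * t))
        = ((x : ℂ) ^ (z - 1) * Complex.exp (-(t * x))) * Complex.exp (-((1 : ℝ) * t)) := by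
      intro x
      rw [mul_assoc, ← Complex.exp_add]
      congr 2
      push_cast
      ring
    simp_rw [h2]
    rw [integral_mul_const, this, one_div, Complex.inv_cpow _ _
      (by rw [Complex.arg_ofReal_of_nonneg (le_of_lt ht)]; exact Real.pi_pos.ne),
      ← Complex.cpow_neg]
    ring_nf
  have hint : Integrable (Function.uncurry fun x t : ℝ => (x : ℂ) ^ (z - 1) *
      Complex.exp (-((1 + x : ℝ) * t)))
      ((volume.restrict (Ioi 0)).prod (volume.restrict (Ioi 0))) := by
    rw [integrable_prod_iff]
    · constructor
      · filter_upwards [self_mem_ae_restrict measurableSet_Ioi] with x hx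
        have hx' : (0 : ℝ) < 1 + x := by have := mem_Ioi.1 hx; positivity
        have h4 : IntegrableOn (fun t : ℝ => Real.exp (-(1 + x) * t)) (Ioi 0) :=
          integrableOn_exp_mul_Ioi (by linarith) 0
        have h5 : IntegrableOn (fun t : ℝ => ((Real.exp (-(1 + x) * t) : ℝ) : ℂ)) (Ioi 0) :=
          Integrable.ofReal h4
        refine (h5.const_mul ((x : ℂ) ^ (z - 1))).congr (ae_of_all _ fun t => ?_)
        simp only [Function.uncurry_apply_pair, Complex.ofReal_exp, Complex.ofReal_mul,
          Complex.ofReal_neg, neg_mul]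
      · have := integrableOn_rpow_mul_inv_one_add h0 h1
        refine this.congr_fun (fun x hx => ?_) measurableSet_Ioi
        have hx' : (0 : ℝ) < 1 + x := by have := mem_Ioi.1 hx; positivity
        have h3 : ∀ t : ℝ, ‖(x : ℂ) ^ (z - 1) * Complex.exp (-((1 + x : ℝ) * t))‖
            = x ^ (z.re - 1) * Real.exp (-(1 + x) * t) := by
          intro t
          rw [norm_mul, norm_ofReal_cpow hx, Complex.norm_exp, ← Complex.ofReal_mul,
            ← Complex.ofReal_neg, Complex.ofReal_re, neg_mul]
          simp
        simp only [Function.uncurry_apply_pair]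
        simp_rw [h3]
        rw [integral_const_mul, integral_exp_mul_Ioi (by linarith), mul_zero, Real.exp_zero,
          neg_div_neg_eq, one_div]
    · refine AEStronglyMeasurable.mul ?_ (Continuous.aestronglyMeasurable (by fun_prop))
      exact (((continuousOn_ofReal_cpow _).aestronglyMeasurable measurableSet_Ioi)).comp_fst
  rw [← setIntegral_congr_fun measurableSet_Ioi hexp, integral_integral_swap hint,
    setIntegral_congr_fun measurableSet_Ioi hgam, integral_const_mul,
    Complex.integral_cpow_mul_exp_neg_mul_Ioi (by simpa using h1) one_pos,
    ← Complex.Gamma_mul_Gamma_one_sub]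
  simp

theorem norm_inv_ofReal_add_le {x δ : ℝ} (hx : 0 < x) (hδ : 0 < δ) {w : ℂ} (hw : δ ≤ w.re) :
    ‖((x : ℂ) + w)⁻¹‖ ≤ δ⁻¹ ∧ ‖((x : ℂ) + w)⁻¹‖ ≤ (min 1 δ)⁻¹ * (1 + x)⁻¹ := by
  have h1 : x + δ ≤ ‖(x : ℂ) + w‖ := by
    refine le_trans ?_ (Complex.re_le_norm _)
    simpa using hw
  have hm : 0 < min 1 δ := lt_min one_pos hδ
  rw [norm_inv, ← mul_inv]
  refine ⟨inv_anti₀ hδ (by linarith), inv_anti₀ (by positivity) (le_trans ?_ h1)⟩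
  have h2 : min 1 δ ≤ 1 := min_le_left _ _
  have h3 : min 1 δ ≤ δ := min_le_right _ _
  nlinarith

theorem ofReal_add_ne_zero {x : ℝ} (hx : 0 < x) {w : ℂ} (hw : 0 < w.re) : (x : ℂ) + w ≠ 0 := by
  intro h
  have := congrArg Complex.re h
  simp at this
  linarith

theorem continuousOn_inv_ofReal_add {w : ℂ} (hw : 0 < w.re) :
    ContinuousOn (fun x : ℝ => ((x : ℂ) + w)⁻¹) (Ioi 0) :=
  ContinuousOn.inv₀ (by fun_prop) fun _ hx => ofReal_add_ne_zero hx hw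

/-- Analyticity in `w`, needed for the identity theorem in `mellin_inv_add`. On `Re v > Re w / 2`
the derivative of the integrand is dominated by a multiple of `x^(Re z - 1) / (1 + x)`. -/
theorem differentiableAt_mellin_inv_add {z : ℂ} (h0 : 0 < z.re) (h1 : z.re < 1) {w : ℂ}
    (hw : 0 < w.re) :
    MellinConvergent (fun x : ℝ => ((x : ℂ) + w)⁻¹) z ∧
      DifferentiableAt ℂ (fun w : ℂ => mellin (fun x : ℝ => ((x : ℂ) + w)⁻¹) z) w := by
  have hbase := integrableOn_rpow_mul_inv_one_add h0 h1
  set δ := w.re / 2 with hδ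
  have hδ0 : 0 < δ := by positivity
  have hmeas : ∀ v : ℂ, 0 < v.re → AEStronglyMeasurable
      (fun x : ℝ => (x : ℂ) ^ (z - 1) • ((x : ℂ) + v)⁻¹) (volume.restrict (Ioi 0)) := fun v hv =>
    ((continuousOn_ofReal_cpow _).smul
      (continuousOn_inv_ofReal_add hv)).aestronglyMeasurable measurableSet_Ioi
  have hint : MellinConvergent (fun x : ℝ => ((x : ℂ) + w)⁻¹) z := by
    refine (hbase.const_mul (min 1 δ)⁻¹).mono' (hmeas w hw) ?_
    filter_upwards [self_mem_ae_restrict measurableSet_Ioi] with x hx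
    have := (norm_inv_ofReal_add_le hx hδ0 (show δ ≤ w.re by linarith)).2
    rw [norm_smul, norm_ofReal_cpow hx, Complex.sub_re, Complex.one_re]
    calc _ ≤ x ^ (z.re - 1) * ((min 1 δ)⁻¹ * (1 + x)⁻¹) := by
          have hx0 : 0 < x := hx
          gcongr
      _ = _ := by ring
  refine ⟨hint, ?_⟩
  have hs : {v : ℂ | δ < v.re} ∈ 𝓝 w :=
    (isOpen_lt continuous_const Complex.continuous_re).mem_nhds (by
      show δ < w.re
      linarith)
  refine (hasDerivAt_integral_of_dominated_loc_of_deriv_le (μ := volume.restrict (Ioi 0)) hs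
    (F := fun v x => (x : ℂ) ^ (z - 1) • ((x : ℂ) + v)⁻¹)
    (F' := fun v x => (x : ℂ) ^ (z - 1) • (-(((x : ℂ) + v)⁻¹ * ((x : ℂ) + v)⁻¹)))
    (bound := fun x => δ⁻¹ * (min 1 δ)⁻¹ * (x ^ (z.re - 1) * (1 + x)⁻¹)) ?_ hint ?_ ?_ ?_ ?_
    ).2.differentiableAt
  · filter_upwards [hs] with v hv
    exact hmeas v (hδ0.trans hv)
  · exact ((continuousOn_ofReal_cpow _).smul (((continuousOn_inv_ofReal_add hw).mul
      (continuousOn_inv_ofReal_add hw)).neg)).aestronglyMeasurable measurableSet_Ioi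
  · filter_upwards [self_mem_ae_restrict measurableSet_Ioi] with x hx v hv
    have hx0 : 0 < x := hx
    have hb := norm_inv_ofReal_add_le hx hδ0 (le_of_lt hv)
    rw [norm_smul, norm_ofReal_cpow hx, Complex.sub_re, Complex.one_re, norm_neg, norm_mul]
    calc _ ≤ x ^ (z.re - 1) * (δ⁻¹ * ((min 1 δ)⁻¹ * (1 + x)⁻¹)) := by
          gcongr
          · exact hb.1
          · exact hb.2
      _ = _ := by ring
  · exact hbase.const_mul _
  · filter_upwards [self_mem_ae_restrict measurableSet_Ioi] with x hx v hv
    have hne := ofReal_add_ne_zero hx (hδ0.trans hv)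
    convert! (((hasDerivAt_id v).const_add (x : ℂ)).inv hne).const_smul ((x : ℂ) ^ (z - 1)) using 1
    simp
    field_simp

theorem mellin_inv_add_ofReal {z : ℂ} (h0 : 0 < z.re) (h1 : z.re < 1) {r : ℝ} (hr : 0 < r) :
    mellin (fun x : ℝ => ((x : ℂ) + r)⁻¹) z =
      (r : ℂ) ^ (z - 1) * (Real.pi / Complex.sin (Real.pi * z)) := by
  have h2 : (fun x : ℝ => ((x : ℂ) + r)⁻¹) =
      fun x : ℝ => (r : ℂ)⁻¹ • (fun y : ℝ => (1 + y : ℂ)⁻¹) (r⁻¹ * x) := by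
    funext x
    have : (r : ℂ) ≠ 0 := Complex.ofReal_ne_zero.2 hr.ne'
    simp only [smul_eq_mul, ← mul_inv]
    push_cast
    rw [mul_add, mul_inv_cancel_left₀ this, mul_one, add_comm]
  rw [h2, mellin_const_smul, mellin_comp_mul_left (fun y : ℝ => (1 + y : ℂ)⁻¹) _ (inv_pos.2 hr),
    Complex.ofReal_inv,
    Complex.inv_cpow _ _ (by rw [Complex.arg_ofReal_of_nonneg hr.le]; exact Real.pi_pos.ne),
    Complex.cpow_neg, inv_inv, mellin]
  simp only [smul_eq_mul]
  rw [integral_cpow_div_one_add h0 h1, Complex.cpow_sub _ _ (Complex.ofReal_ne_zero.2 hr.ne'),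
    Complex.cpow_one]
  ring

/-- Both sides are analytic in `w` on the right half-plane and agree at the positive reals `1 +
1/(n+1)`, which accumulate at `1`. -/
theorem mellin_inv_add {z : ℂ} (h0 : 0 < z.re) (h1 : z.re < 1) {w : ℂ} (hw : 0 < w.re) :
    mellin (fun x : ℝ => ((x : ℂ) + w)⁻¹) z =
      w ^ (z - 1) * (Real.pi / Complex.sin (Real.pi * z)) := by
  have hopen : IsOpen {v : ℂ | 0 < v.re} := isOpen_lt continuous_const Complex.continuous_re
  have hf : AnalyticOnNhd ℂ (fun w : ℂ => mellin (fun x : ℝ => ((x : ℂ) + w)⁻¹) z)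
      {v : ℂ | 0 < v.re} := DifferentiableOn.analyticOnNhd (fun v hv =>
        (differentiableAt_mellin_inv_add h0 h1 hv).2.differentiableWithinAt) hopen
  have hg : AnalyticOnNhd ℂ (fun w : ℂ => w ^ (z - 1) * (Real.pi / Complex.sin (Real.pi * z)))
      {v : ℂ | 0 < v.re} := fun v hv =>
        (analyticAt_id.cpow analyticAt_const (Or.inl hv)).mul analyticAt_const
  refine hf.eqOn_of_preconnected_of_frequently_eq hg
    (convex_halfSpace_re_gt 0).isPreconnected (z₀ := 1) (by simp) ?_ hw
  have ht : Tendsto (fun n : ℕ => (((1 + 1 / ((n : ℝ) + 1) : ℝ)) : ℂ)) atTop (𝓝[≠] 1) := by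
    refine tendsto_nhdsWithin_iff.2 ⟨?_, Eventually.of_forall fun n => ?_⟩
    · have := (tendsto_one_div_add_atTop_nhds_zero_nat (𝕜 := ℝ)).const_add 1
      simpa [Function.comp_def] using (Complex.continuous_ofReal.tendsto _).comp this
    · have : (0 : ℝ) < 1 / ((n : ℝ) + 1) := by positivity
      rw [mem_compl_singleton_iff, Ne, Complex.ofReal_eq_one]
      linarith
  refine ht.frequently (Eventually.frequently (Eventually.of_forall fun n => ?_))
  exact mellin_inv_add_ofReal h0 h1 (by positivity)

/-! ### The Mellin transform of a single logarithmic kernel -/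

theorem ofReal_div_re_nonneg {x : ℝ} (hx : 0 < x) {w : ℂ} (hw : 0 < w.re) : 0 ≤ (x / w : ℂ).re := by
  rw [Complex.div_re]
  simp only [Complex.ofReal_re, Complex.ofReal_im, zero_mul, zero_div, add_zero]
  exact div_nonneg (mul_nonneg hx.le hw.le) (Complex.normSq_nonneg _)

theorem continuousOn_logKernel_div (p : ℕ) {w : ℂ} (hw : 0 < w.re) :
    ContinuousOn (fun x : ℝ => logKernel p (x / w)) (Ioi 0) := fun x hx =>
  (ContinuousAt.comp (f := fun x : ℝ => (x / w : ℂ))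
    (hasDerivAt_logKernel p (ofReal_div_re_nonneg hx hw)).continuousAt
    (Continuous.continuousAt (by fun_prop))).continuousWithinAt

theorem norm_logKernel_div_le (p : ℕ) {q : ℝ} (hq : (p : ℝ) < q) (hq' : q ≤ p + 1) {w : ℂ}
    (hw : 0 < w.re) {x : ℝ} (hx : 0 < x) :
    ‖logKernel p (x / w)‖ ≤ (‖w‖⁻¹ * x) ^ q / q := by
  refine (norm_logKernel_le p hq hq' (ofReal_div_re_nonneg hx hw)).trans (le_of_eq ?_)
  rw [norm_div, Complex.norm_of_nonneg hx.le, div_eq_inv_mul x]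

theorem isBigO_logKernel_div (p : ℕ) {q : ℝ} (hq : (p : ℝ) < q) (hq' : q ≤ p + 1) {w : ℂ}
    (hw : 0 < w.re) {l : Filter ℝ} (hl : ∀ᶠ x in l, 0 < x) :
    (fun x : ℝ => logKernel p (x / w)) =O[l] fun x => x ^ q := by
  refine IsBigO.of_bound ((‖w‖⁻¹) ^ q / q) ?_
  filter_upwards [hl] with x hx
  refine (norm_logKernel_div_le p hq hq' hw hx).trans (le_of_eq ?_)
  rw [Real.mul_rpow (by positivity) hx.le, Real.norm_of_nonneg (by positivity)]
  ring

theorem mellinConvergent_logKernel_div (p : ℕ) {w : ℂ} (hw : 0 < w.re) {s : ℂ}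
    (h0 : (p : ℝ) < s.re) (h1 : s.re < p + 1) :
    MellinConvergent (fun x : ℝ => logKernel p (x / w)) (-s) := by
  refine mellinConvergent_of_isBigO_rpow (a := -((p + s.re) / 2)) (b := -(p + 1))
    ((continuousOn_logKernel_div p hw).locallyIntegrableOn measurableSet_Ioi) ?_ ?_ ?_ ?_
  · rw [neg_neg]
    exact isBigO_logKernel_div p (by linarith) (by linarith) hw (eventually_gt_atTop 0)
  · rw [Complex.neg_re]
    linarith
  · rw [neg_neg]
    exact isBigO_logKernel_div p (by linarith) le_rfl hw self_mem_nhdsWithin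
  · rw [Complex.neg_re]
    linarith

theorem tendsto_cpow_mul_logKernel_div (p : ℕ) {w : ℂ} (hw : 0 < w.re) {s : ℂ}
    {q : ℝ} (hq : (p : ℝ) < q) (hq' : q ≤ p + 1)
    {l : Filter ℝ} (hl : ∀ᶠ x in l, 0 < x) (ht : Tendsto (fun x : ℝ => x ^ (q - s.re)) l (𝓝 0)) :
    Tendsto (fun x : ℝ => (x : ℂ) ^ (-s) / (-s) * logKernel p (x / w)) l (𝓝 0) := by
  have h1 : (fun x : ℝ => (x : ℂ) ^ (-s) / (-s)) =O[l] fun x => x ^ (-s.re) := by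
    refine IsBigO.of_bound (‖-s‖⁻¹) ?_
    filter_upwards [hl] with x hx
    rw [norm_div, norm_ofReal_cpow hx, Complex.neg_re, Real.norm_of_nonneg (by positivity)]
    exact le_of_eq (by ring)
  refine (h1.mul (isBigO_logKernel_div p hq hq' hw hl)).trans_tendsto (ht.congr' ?_)
  filter_upwards [hl] with x hx
  rw [← Real.rpow_add hx]
  congr 1
  ring

/-- Integration by parts against `x^(-s)/(-s)` replaces the kernel by a multiple of `x^(z-1)/(x+w)`
with `z = p + 1 - s`, whose real part lies in `(0, 1)`. The boundary terms vanish because `p < Re s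
< p + 1`, and the sign `(-1)^p` cancels against `sin πz = (-1)^p sin πs`. -/
theorem mellin_logKernel_div (p : ℕ) {w : ℂ} (hw : 0 < w.re) {s : ℂ}
    (h0 : (p : ℝ) < s.re) (h1 : s.re < p + 1) :
    mellin (fun x : ℝ => logKernel p (x / w)) (-s) =
      w ^ (-s) * (Real.pi / (s * Complex.sin (Real.pi * s))) := by
  have hs0 : 0 < s.re := (Nat.cast_nonneg p).trans_lt h0
  have hs : s ≠ 0 := fun h => by simp [h] at hs0
  have hw0 : w ≠ 0 := fun h => by simp [h] at hw
  set z : ℂ := p + 1 - s with hz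
  have hz0 : 0 < z.re := by simp [hz]; linarith
  have hz1 : z.re < 1 := by simp [hz]; linarith
  have hu : ∀ x ∈ Ioi (0 : ℝ), HasDerivAt (fun x : ℝ => (x : ℂ) ^ (-s) / (-s))
      ((x : ℂ) ^ (-s - 1)) x := by
    intro x hx
    have := hasDerivAt_ofReal_cpow_const' (x := x) (ne_of_gt hx) (r := -s - 1)
      (by simpa using hs)
    simpa using this
  have hv : ∀ x ∈ Ioi (0 : ℝ), HasDerivAt (fun x : ℝ => logKernel p (x / w))
      ((-(x / w : ℂ)) ^ p * (1 + x / w)⁻¹ * (1 / w)) x := by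
    intro x hx
    have h2 : HasDerivAt (fun x : ℝ => (x / w : ℂ)) (1 / w) x :=
      (Complex.ofRealCLM.hasDerivAt (x := x)).div_const w
    exact (hasDerivAt_logKernel p (ofReal_div_re_nonneg hx hw)).comp x h2
  have huv : ∀ x ∈ Ioi (0 : ℝ), (x : ℂ) ^ (-s) / (-s) *
      ((-(x / w : ℂ)) ^ p * (1 + x / w)⁻¹ * (1 / w)) =
      (-((-1) ^ p / (s * w ^ p))) * ((x : ℂ) ^ (z - 1) • ((x : ℂ) + w)⁻¹) := by
    intro x hx
    have hx0 : (x : ℂ) ≠ 0 := Complex.ofReal_ne_zero.2 (ne_of_gt hx)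
    have hxw := ofReal_add_ne_zero hx hw
    have h3 : (x : ℂ) ^ (z - 1) = (x : ℂ) ^ (-s) * (x : ℂ) ^ p := by
      rw [← Complex.cpow_natCast, ← Complex.cpow_add _ _ hx0]
      congr 1
      rw [hz]
      ring
    have h4 : (1 + x / w : ℂ)⁻¹ = w * ((x : ℂ) + w)⁻¹ := by
      have : (1 + x / w : ℂ) = ((x : ℂ) + w) / w := by field_simp; ring
      rw [this, inv_div, div_eq_mul_inv]
    rw [h3, h4, neg_pow, div_pow, smul_eq_mul]
    field_simp
  have hconv := differentiableAt_mellin_inv_add hz0 hz1 hw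
  have hpart := integral_Ioi_mul_deriv_eq_deriv_mul (a := (0 : ℝ)) (a' := (0 : ℂ)) (b' := (0 : ℂ))
    hu hv (IntegrableOn.congr_fun (Integrable.const_mul hconv.1 _) (fun x hx => (huv x hx).symm)
      measurableSet_Ioi)
    (mellinConvergent_logKernel_div p hw h0 h1)
    (tendsto_cpow_mul_logKernel_div p hw (q := p + 1) (by linarith) le_rfl self_mem_nhdsWithin ?_)
    (tendsto_cpow_mul_logKernel_div p hw (q := (p + s.re) / 2) (by linarith) (by linarith)
      (eventually_gt_atTop 0) ?_)
  · rw [setIntegral_congr_fun measurableSet_Ioi huv, integral_const_mul] at hpart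
    have h5 : mellin (fun x : ℝ => ((x : ℂ) + w)⁻¹) z = _ := mellin_inv_add hz0 hz1 hw
    have h6 : w ^ (z - 1) = w ^ (-s) * w ^ p := by
      rw [← Complex.cpow_natCast, ← Complex.cpow_add _ _ hw0]
      congr 1
      rw [hz]
      ring
    have h7 : Complex.sin (Real.pi * z) = (-1) ^ p * Complex.sin (Real.pi * s) := by
      have : (Real.pi * z : ℂ) = (Real.pi - Real.pi * s) + p * Real.pi := by rw [hz]; ring
      rw [this, Complex.sin_antiperiodic.add_nat_mul_eq, Complex.sin_pi_sub]
    have h8 : ((-1 : ℂ) ^ p) ≠ 0 := pow_ne_zero _ (by norm_num)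
    rw [mellin] at h5 ⊢
    rw [h5, h6, h7] at hpart
    simp only [smul_eq_mul] at hpart ⊢
    rw [sub_zero, zero_sub, neg_mul, neg_inj] at hpart
    rw [← hpart, ← div_div]
    have h9 : w ^ p ≠ 0 := pow_ne_zero _ hw0
    field_simp
  · have h2 : 0 < (p : ℝ) + 1 - s.re := by linarith
    have := (Real.continuousAt_rpow_const 0 _ (Or.inr h2.le)).tendsto
    rw [Real.zero_rpow h2.ne'] at this
    exact this.mono_left nhdsWithin_le_nhds
  · have h2 : 0 < s.re - ((p : ℝ) + s.re) / 2 := by linarith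
    simpa using tendsto_rpow_neg_atTop h2

/-- An `L¹` bound uniform in `w`, obtained by the scaling `x ↦ x/‖w‖` from one fixed integrable
majorant. It makes the interchange of sum and integral over the sequence legitimate. -/
theorem exists_integral_norm_logKernel_div_le (p : ℕ) {s : ℂ}
    (h0 : (p : ℝ) < s.re) (h1 : s.re < p + 1) :
    ∃ C : ℝ, ∀ w : ℂ, 0 < w.re →
      ∫ x in Ioi (0 : ℝ), ‖(x : ℂ) ^ (-s - 1) • logKernel p (x / w)‖ ≤ C * ‖w‖ ^ (-s.re) := by
  have hp0 : (0 : ℝ) ≤ p := Nat.cast_nonneg p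
  set q : ℝ := (p + s.re) / 2 with hq
  -- The power `p + 1 > Re s` gives integrability at `0`, the power `q < Re s` at infinity.
  set h : ℝ → ℝ := fun y => min (y ^ ((p : ℝ) + 1) / (p + 1)) (y ^ q / q) with hh
  have hq0 : 0 < q := by rw [hq]; linarith
  have hnn : ∀ y : ℝ, 0 < y → 0 ≤ h y := fun y hy => le_min (by positivity) (by positivity)
  have hint : IntegrableOn (fun y : ℝ => y ^ (-s.re - 1) * h y) (Ioi 0) := by
    refine mellin_convergent_of_isBigO_scalar (a := -q) (b := -(p + 1)) ?_ ?_ (by linarith) ?_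
      (by linarith)
    · refine ContinuousOn.locallyIntegrableOn (fun x hx => ContinuousAt.continuousWithinAt ?_)
        measurableSet_Ioi
      have hx0 : x ≠ 0 := ne_of_gt hx
      exact ((Real.continuousAt_rpow_const x _ (Or.inl hx0)).div_const _).min
        ((Real.continuousAt_rpow_const x _ (Or.inl hx0)).div_const _)
    · refine IsBigO.of_bound (1 / q) ?_
      filter_upwards [eventually_gt_atTop 0] with x hx
      rw [Real.norm_of_nonneg (hnn x hx), neg_neg, Real.norm_of_nonneg (by positivity)]
      refine (min_le_right _ _).trans (le_of_eq ?_)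
      ring
    · refine IsBigO.of_bound (1 / (p + 1)) ?_
      filter_upwards [self_mem_nhdsWithin] with x hx
      have hx0 : 0 < x := hx
      rw [Real.norm_of_nonneg (hnn x hx), neg_neg, Real.norm_of_nonneg (by positivity)]
      refine (min_le_left _ _).trans (le_of_eq ?_)
      ring
  refine ⟨∫ y in Ioi (0 : ℝ), y ^ (-s.re - 1) * h y, fun w hw => ?_⟩
  have hw0 : 0 < ‖w‖ := norm_pos_iff.2 fun h => by simp [h] at hw
  set b : ℝ := ‖w‖⁻¹ with hb
  have hb0 : 0 < b := inv_pos.2 hw0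
  have hscale : ∀ x ∈ Ioi (0 : ℝ), x ^ (-s.re - 1) * h (b * x) =
      b ^ (s.re + 1) * ((b * x) ^ (-s.re - 1) * h (b * x)) := by
    intro x hx
    have hx0 : 0 < x := hx
    rw [Real.mul_rpow hb0.le hx0.le, ← mul_assoc, ← mul_assoc, ← Real.rpow_add hb0]
    have : s.re + 1 + (-s.re - 1) = 0 := by ring
    rw [this, Real.rpow_zero, one_mul]
  have hint2 : IntegrableOn (fun x : ℝ => x ^ (-s.re - 1) * h (b * x)) (Ioi 0) := by
    refine IntegrableOn.congr_fun ?_ (fun x hx => (hscale x hx).symm) measurableSet_Ioi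
    refine Integrable.const_mul ?_ _
    exact (integrableOn_Ioi_comp_mul_left_iff (fun y => y ^ (-s.re - 1) * h y) 0 hb0).2
      (by simpa using hint)
  calc ∫ x in Ioi (0 : ℝ), ‖(x : ℂ) ^ (-s - 1) • logKernel p (x / w)‖
      ≤ ∫ x in Ioi (0 : ℝ), x ^ (-s.re - 1) * h (b * x) := by
        refine setIntegral_mono_on (mellinConvergent_logKernel_div p hw h0 h1).norm hint2
          measurableSet_Ioi fun x hx => ?_
        have hx0 : 0 < x := hx
        rw [norm_smul, norm_ofReal_cpow hx, Complex.sub_re, Complex.neg_re, Complex.one_re]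
        gcongr
        exact le_min (norm_logKernel_div_le p (by linarith) le_rfl hw hx)
          (norm_logKernel_div_le p (by linarith) (by linarith) hw hx)
    _ = _ := by
        rw [setIntegral_congr_fun measurableSet_Ioi hscale, integral_const_mul,
          integral_comp_mul_left_Ioi (fun y => y ^ (-s.re - 1) * h y) 0 hb0, mul_zero, smul_eq_mul,
          ← mul_assoc, mul_comm]
        congr 1
        rw [Real.rpow_add hb0, Real.rpow_one, mul_assoc, mul_inv_cancel₀ hb0.ne', mul_one, hb,
          Real.inv_rpow hw0.le, Real.rpow_neg hw0.le]

/-! ### Exponent of convergence, genus and the Dirichlet series -/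

section

variable {S : ℕ → ℂ}

theorem re_pos_of_mem_interior_sector {θ c : ℝ} (hc : 0 < c) (hθ : θ < Real.pi) {z : ℂ}
    (hz : z ∈ interior (sector θ c)) : 0 < z.re := by
  have h1 : z ∈ sector θ c := interior_subset hz
  have h2 := Complex.abs_arg_le_pi_div_two_iff.1 (le_trans h1 (by linarith))
  simp at h2
  linarith

theorem neg_ofReal_mem_asymptoticDomain {θ c x : ℝ} (hc : 0 < c) (hθ : θ < Real.pi) (hx : 0 < x) :
    (-x : ℂ) ∈ asymptoticDomain θ c := by
  intro h
  have h1 : |Complex.arg (-x - c)| ≤ θ / 2 := h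
  have h2 : (-x - c : ℂ) = ((-(x + c) : ℝ) : ℂ) := by push_cast; ring
  rw [h2, Complex.arg_ofReal_of_neg (by linarith), abs_of_pos Real.pi_pos] at h1
  linarith [Real.pi_pos]

theorem tendsto_neg_ofReal_atInfinity {θ c : ℝ} (hc : 0 < c) (hθ : θ < Real.pi) :
    Tendsto (fun x : ℝ => (-x : ℂ)) atTop (atInfinity θ c) := by
  refine tendsto_inf.2 ⟨?_, tendsto_principal.2 ?_⟩
  · rw [← tendsto_norm_atTop_iff_cobounded]
    simpa using tendsto_abs_atTop_atTop
  · filter_upwards [eventually_gt_atTop 0] with x hx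
    exact neg_ofReal_mem_asymptoticDomain hc hθ hx

theorem exponent_nonneg (hS : Tendsto (fun n => ‖S n‖) atTop atTop) : 0 ≤ exponent S := by
  refine le_limsup_of_frequently_le (Eventually.frequently ?_)
  filter_upwards [hS.eventually_ge_atTop 1] with n hn
  have h1 : 0 ≤ Real.log ((n : ℝ) + 1) :=
    Real.log_nonneg (by linarith [(Nat.cast_nonneg n : (0 : ℝ) ≤ n)])
  exact EReal.coe_nonneg.2 (div_nonneg h1 (Real.log_nonneg hn))

/-- For `r` strictly between the exponent and `ρ`, eventually `n + 1 < ‖S n‖^r`, so the terms are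
dominated by `(n + 1)^(-ρ/r)`. -/
theorem summable_norm_rpow (hS : Tendsto (fun n => ‖S n‖) atTop atTop) {ρ : ℝ}
    (hρ : exponent S < ρ) : Summable fun n => ‖S n‖ ^ (-ρ) := by
  obtain ⟨r, hr1, hr2⟩ := EReal.lt_iff_exists_real_btwn.1 hρ
  have hr0 : 0 < r := by exact_mod_cast (exponent_nonneg hS).trans_lt hr1
  have hr : r < ρ := by exact_mod_cast hr2
  have hev := eventually_lt_of_limsup_lt hr1
  have hsum : Summable fun n : ℕ => ((n : ℝ) + 1) ^ (-(ρ / r)) := by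
    have h1 : 1 < ρ / r := (one_lt_div hr0).2 hr
    have := (summable_nat_add_iff 1).2 (Real.summable_nat_rpow.2 (show -(ρ / r) < -1 by linarith))
    simpa using this
  refine Summable.of_norm_bounded_eventually hsum ?_
  rw [Nat.cofinite_eq_atTop]
  filter_upwards [hev, hS.eventually_gt_atTop 1] with n hn hn1
  have hlog : 0 < Real.log ‖S n‖ := Real.log_pos hn1
  have hn0 : (0 : ℝ) < (n : ℝ) + 1 := by positivity
  have hpos : 0 < ‖S n‖ := by linarith
  have h2 : Real.log ((n : ℝ) + 1) < r * Real.log ‖S n‖ := (div_lt_iff₀ hlog).1 (by exact_mod_cast hn)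
  rw [Real.norm_of_nonneg (by positivity), Real.rpow_def_of_pos hpos, Real.rpow_def_of_pos hn0,
    Real.exp_le_exp]
  have h3 : Real.log ((n : ℝ) + 1) * (ρ / r) ≤ r * Real.log ‖S n‖ * (ρ / r) := by
    gcongr
    exact div_nonneg (hr0.trans hr).le hr0.le
  have h4 : r * Real.log ‖S n‖ * (ρ / r) = Real.log ‖S n‖ * ρ := by field_simp
  linarith

theorem summable_norm_pow_inv (hS : Tendsto (fun n => ‖S n‖) atTop atTop) {p : ℕ}
    (hp : exponent S < ((p + 1 : ℝ) : EReal)) : Summable fun n : ℕ => (‖S n‖ ^ (p + 1))⁻¹ := by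
  refine (summable_norm_rpow hS hp).congr fun n => ?_
  rw [Real.rpow_neg (norm_nonneg _)]
  norm_cast

theorem summable_genus (hS : Tendsto (fun n => ‖S n‖) atTop atTop) (hE : exponent S < ⊤) :
    Summable fun n : ℕ => (‖S n‖ ^ (genus S + 1))⁻¹ := by
  obtain ⟨r, hr, -⟩ := EReal.lt_iff_exists_real_btwn.1 hE
  obtain ⟨p, hp⟩ := exists_nat_gt r
  refine Nat.sInf_mem (s := {p : ℕ | Summable fun n : ℕ => (‖S n‖ ^ (p + 1))⁻¹})
    ⟨p, summable_norm_pow_inv hS (hr.trans ?_)⟩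
  exact EReal.coe_lt_coe_iff.2 (by linarith)

theorem genus_le_exponent (hS : Tendsto (fun n => ‖S n‖) atTop atTop) :
    (((genus S : ℝ)) : EReal) ≤ exponent S := by
  by_contra! h
  rcases hg : genus S with - | k
  · rw [hg] at h
    exact absurd (exponent_nonneg hS) (not_le.2 (by simpa using h))
  · rw [hg] at h
    have h1 := summable_norm_pow_inv hS (p := k) (by exact_mod_cast h)
    have h2 : genus S ≤ k := Nat.sInf_le h1
    omega

/-- By monotonicity the first `n + 1` terms of the series are each at least the last of them, so `n
+ 1 ≤ T ‖S n‖^(p+1)`; then take logarithms. -/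
theorem exponent_le_of_summable (hne : ∀ n, S n ≠ 0) (hmono : Monotone fun n => ‖S n‖)
    (hS : Tendsto (fun n => ‖S n‖) atTop atTop) {p : ℕ}
    (hp : Summable fun n : ℕ => (‖S n‖ ^ (p + 1))⁻¹) : exponent S ≤ ((p + 1 : ℝ) : EReal) := by
  set T := ∑' n, (‖S n‖ ^ (p + 1))⁻¹ with hT
  have hpos : ∀ n, 0 < ‖S n‖ := fun n => norm_pos_iff.2 (hne n)
  have hbound : ∀ n : ℕ, ((n : ℝ) + 1) * (‖S n‖ ^ (p + 1))⁻¹ ≤ T := by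
    intro n
    refine le_trans ?_ (hp.sum_le_tsum (Finset.range (n + 1)) fun i _ => by
      have := hpos i; positivity)
    have := Finset.card_nsmul_le_sum (Finset.range (n + 1)) (fun i => (‖S i‖ ^ (p + 1))⁻¹)
      ((‖S n‖ ^ (p + 1))⁻¹) fun i hi => by
        have h1 : ‖S i‖ ≤ ‖S n‖ := hmono (by simpa [Nat.lt_succ_iff] using hi)
        have := hpos i
        gcongr
    simpa using this
  have hT0 : 0 < T := lt_of_lt_of_le (by have := hpos 0; positivity) (hbound 0)
  have hlog : Tendsto (fun n => Real.log ‖S n‖) atTop atTop := Real.tendsto_log_atTop.comp hS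
  have hlim : Tendsto (fun n => ((((p : ℝ) + 1) + Real.log T / Real.log ‖S n‖ : ℝ) : EReal)) atTop
      (𝓝 ((p + 1 : ℝ) : EReal)) := by
    refine (continuous_coe_real_ereal.tendsto _).comp ?_
    simpa using (hlog.const_div_atTop (Real.log T)).const_add ((p : ℝ) + 1)
  rw [← hlim.limsup_eq]
  refine limsup_le_limsup ?_
  filter_upwards [hlog.eventually_gt_atTop 0] with n hn
  have h1 : Real.log ((n : ℝ) + 1) ≤ Real.log (T * ‖S n‖ ^ (p + 1)) := by
    refine Real.log_le_log (by positivity) ?_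
    have := hbound n
    rwa [← div_eq_mul_inv, div_le_iff₀ (pow_pos (hpos n) _)] at this
  rw [Real.log_mul hT0.ne' (pow_pos (hpos n) _).ne', Real.log_pow] at h1
  rw [EReal.coe_le_coe_iff, div_le_iff₀ hn, add_mul, div_mul_cancel₀ _ hn.ne']
  push_cast at h1
  linarith

/-- The zeta function of the sequence as a Dirichlet-type series. -/
def zetaSeries (S : ℕ → ℂ) (s : ℂ) : ℂ := ∑' n, S n ^ (-s)

theorem norm_cpow_neg_le {w : ℂ} (hw : w ≠ 0) (s : ℂ) :
    ‖w ^ (-s)‖ ≤ ‖w‖ ^ (-s.re) * Real.exp (Real.pi * |s.im|) := by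
  rw [Complex.norm_cpow_of_ne_zero hw, div_eq_mul_inv, ← Real.exp_neg, Complex.neg_re,
    Complex.neg_im]
  gcongr
  rw [mul_neg, neg_neg]
  calc w.arg * s.im ≤ |w.arg * s.im| := le_abs_self _
    _ = |w.arg| * |s.im| := abs_mul _ _
    _ ≤ _ := by
      gcongr
      exact Complex.abs_arg_le_pi w

theorem summable_cpow_neg (hne : ∀ n, S n ≠ 0) {s : ℂ}
    (hs : Summable fun n => ‖S n‖ ^ (-s.re)) : Summable fun n => S n ^ (-s) :=
  Summable.of_norm_bounded (hs.mul_right _) fun n => norm_cpow_neg_le (hne n) s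

theorem analyticAt_zetaSeries (hne : ∀ n, S n ≠ 0) (hS : Tendsto (fun n => ‖S n‖) atTop atTop)
    {s : ℂ} (hs : exponent S < ((s.re : ℝ) : EReal)) : AnalyticAt ℂ (zetaSeries S) s := by
  obtain ⟨r, hr1, hr2⟩ := EReal.lt_iff_exists_real_btwn.1 hs
  have hr : r < s.re := by exact_mod_cast hr2
  set U : Set ℂ := {z | r < z.re} ∩ {z | |z.im| < |s.im| + 1} with hU
  have hopen : IsOpen U := (isOpen_lt continuous_const Complex.continuous_re).inter
    (isOpen_lt (continuous_abs.comp Complex.continuous_im) continuous_const)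
  have hmem : s ∈ U := ⟨hr, by simp⟩
  -- From `n₀` on the norms are at least `1`, so `‖S n‖^(-Re z) ≤ ‖S n‖^(-r)` on `U`; the bound on
  -- `Im z` controls the factor coming from the argument.
  obtain ⟨n₀, hn₀⟩ := eventually_atTop.1 (hS.eventually_ge_atTop 1)
  set C : ℝ := Real.exp (Real.pi * (|s.im| + 1))
  have hdiff : DifferentiableOn ℂ (fun z => ∑' n, S (n + n₀) ^ (-z)) U := by
    refine Complex.differentiableOn_tsum_of_summable_norm (u := fun n => ‖S (n + n₀)‖ ^ (-r) * C)
      (((summable_nat_add_iff n₀).2 (summable_norm_rpow hS hr1)).mul_right _) (fun n z _ => ?_)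
      hopen fun n z hz => ?_
    · exact ((differentiableAt_id.neg).const_cpow (Or.inl (hne _))).differentiableWithinAt
    · refine (norm_cpow_neg_le (hne _) z).trans ?_
      have h1 : r < z.re := hz.1
      have h2 : |z.im| < |s.im| + 1 := hz.2
      have h3 : 1 ≤ ‖S (n + n₀)‖ := hn₀ _ (Nat.le_add_left _ _)
      have := Real.pi_pos
      simp only [C]
      gcongr
  have h1 : AnalyticAt ℂ (fun z => ∑ i ∈ Finset.range n₀, S i ^ (-z) +
      ∑' n, S (n + n₀) ^ (-z)) s := by
    refine AnalyticAt.add ?_ (hdiff.analyticAt (hopen.mem_nhds hmem))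
    refine Finset.analyticAt_fun_sum _ fun i _ => ?_
    exact (Differentiable.analyticAt (fun z =>
      (differentiableAt_id.neg).const_cpow (Or.inl (hne i))) s)
  refine h1.congr ?_
  filter_upwards [hopen.mem_nhds hmem] with z hz
  refine (summable_cpow_neg hne (summable_norm_rpow hS ?_)).sum_add_tsum_nat_add n₀
  exact hr1.trans (by exact_mod_cast hz.1)

end

/-! ### The Mellin transform of the regularized `log Γ` -/

section

variable {S : ℕ → ℂ}

theorem logKernel_eq (p : ℕ) (u : ℂ) :
    logKernel p u = Complex.log (1 + u) + ∑ j ∈ Finset.Icc 1 p, (-1) ^ j / (j : ℂ) * u ^ j := by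
  rw [logKernel, Complex.logTaylor, Finset.range_eq_Ico, Finset.sum_eq_sum_Ico_succ_bot (by omega),
    sub_eq_add_neg]
  congr 1
  simp only [Nat.cast_zero, div_zero, zero_add]
  rw [← Finset.sum_neg_distrib]
  refine Finset.sum_congr (by ext; simp) fun j _ => ?_
  rw [pow_succ]
  ring

theorem logGamma_eq (S : ℕ → ℂ) (z : ℂ) :
    logGamma S z = -∑' n, logKernel (genus S) (z / S n) := by
  simp only [logGamma, logKernel_eq, div_pow]

theorem logKernel_succ (p : ℕ) (u : ℂ) :
    logKernel (p + 1) u = logKernel p u + (-1) ^ (p + 1) / ((p + 1 : ℕ) : ℂ) * u ^ (p + 1) := by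
  rw [logKernel_eq, logKernel_eq, Finset.sum_Icc_succ_top (by omega), add_assoc]

/-- The sum defining `log Γ(x, S)`, with Taylor polynomials of degree `p`. -/
def regLogGamma (S : ℕ → ℂ) (p : ℕ) (x : ℝ) : ℂ := -∑' n, logKernel p (x / S n)

theorem summable_logKernel (hre : ∀ n, 0 < (S n).re) {p : ℕ} {q : ℝ} (hq : (p : ℝ) < q)
    (hq' : q ≤ p + 1) (hs : Summable fun n => ‖S n‖ ^ (-q)) {x : ℝ} (hx : 0 < x) :
    (Summable fun n => logKernel p (x / S n)) ∧
      ‖regLogGamma S p x‖ ≤ ((∑' n, ‖S n‖ ^ (-q)) / q) * x ^ q := by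
  have h1 : ∀ n, ‖logKernel p (x / S n)‖ ≤ ‖S n‖ ^ (-q) * (x ^ q / q) := fun n => by
    refine (norm_logKernel_div_le p hq hq' (hre n) hx).trans (le_of_eq ?_)
    rw [Real.mul_rpow (by positivity) hx.le, Real.inv_rpow (norm_nonneg _),
      Real.rpow_neg (norm_nonneg _)]
    ring
  refine ⟨Summable.of_norm_bounded (hs.mul_right _) h1, ?_⟩
  rw [regLogGamma, norm_neg]
  refine (tsum_of_norm_bounded (hs.mul_right (x ^ q / q)).hasSum h1).trans (le_of_eq ?_)
  rw [tsum_mul_right]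
  ring

theorem isBigO_regLogGamma (hre : ∀ n, 0 < (S n).re) {p : ℕ} {q : ℝ} (hq : (p : ℝ) < q)
    (hq' : q ≤ p + 1) (hs : Summable fun n => ‖S n‖ ^ (-q)) {l : Filter ℝ} (hl : ∀ᶠ x in l, 0 < x) :
    regLogGamma S p =O[l] fun x => x ^ q := by
  refine IsBigO.of_bound ((∑' n, ‖S n‖ ^ (-q)) / q) ?_
  filter_upwards [hl] with x hx
  rw [Real.norm_of_nonneg (by positivity : 0 ≤ x ^ q)]
  exact (summable_logKernel hre hq hq' hs hx).2

theorem continuousOn_regLogGamma (hre : ∀ n, 0 < (S n).re) {p : ℕ}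
    (hs : Summable fun n => ‖S n‖ ^ (-((p : ℝ) + 1))) : ContinuousOn (regLogGamma S p) (Ioi 0) := by
  intro x hx
  have hx0 : 0 < x := hx
  have hp : (0 : ℝ) < p + 1 := by positivity
  have h1 : ContinuousOn (fun y : ℝ => ∑' n, logKernel p (y / S n)) (Ioo 0 (x + 1)) := by
    refine continuousOn_tsum (u := fun n => ‖S n‖ ^ (-((p : ℝ) + 1)) *
      ((x + 1) ^ ((p : ℝ) + 1) / (p + 1))) (fun n => (continuousOn_logKernel_div p (hre n)).mono
        Ioo_subset_Ioi_self) (hs.mul_right _) fun n y hy => ?_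
    refine (norm_logKernel_div_le p (by linarith) le_rfl (hre n) hy.1).trans ?_
    rw [Real.mul_rpow (by positivity) hy.1.le, Real.inv_rpow (norm_nonneg _),
      Real.rpow_neg (norm_nonneg _), mul_div_assoc]
    gcongr
    · exact hy.1.le
    · exact hy.2.le
  exact ((h1.continuousAt (Ioo_mem_nhds hx0 (by linarith))).neg).continuousWithinAt

theorem regLogGamma_genus (S : ℕ → ℂ) (x : ℝ) : regLogGamma S (genus S) x = logGamma S x := by
  rw [logGamma_eq, regLogGamma]

/-- Raising the Taylor degree by one subtracts a monomial from each kernel, and these sum to a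
single monomial because `∑ (S n)^(-p-1)` converges absolutely. -/
theorem regLogGamma_succ (hre : ∀ n, 0 < (S n).re) {p : ℕ}
    (hs : Summable fun n => ‖S n‖ ^ (-((p : ℝ) + 1))) {x : ℝ} (hx : 0 < x) :
    regLogGamma S (p + 1) x = regLogGamma S p x +
      (-((-1) ^ (p + 1) / ((p + 1 : ℕ) : ℂ) * ∑' n, (S n ^ (p + 1))⁻¹)) * (x : ℂ) ^ (p + 1) := by
  have h1 := (summable_logKernel hre (p := p) (by linarith) le_rfl hs hx).1
  have h2 : Summable fun n => (S n ^ (p + 1))⁻¹ := by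
    refine Summable.of_norm_bounded hs fun n => le_of_eq ?_
    rw [norm_inv, norm_pow, Real.rpow_neg (norm_nonneg _)]
    norm_cast
  rw [regLogGamma, regLogGamma, mul_comm (-_ : ℂ), ← neg_mul_comm, ← mul_assoc, ← tsum_mul_left]
  simp_rw [logKernel_succ]
  have h3 : ∀ n, (-1) ^ (p + 1) / ((p + 1 : ℕ) : ℂ) * (x / S n : ℂ) ^ (p + 1) =
      (x : ℂ) ^ (p + 1) * ((-1) ^ (p + 1) / ((p + 1 : ℕ) : ℂ)) * (S n ^ (p + 1))⁻¹ := fun n => by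
    rw [div_pow]
    ring
  simp_rw [h3]
  rw [h1.tsum_add (h2.mul_left _)]
  simp only [neg_mul, tsum_neg, tsum_mul_left, neg_add]

theorem mellin_regLogGamma (hre : ∀ n, 0 < (S n).re)
    (hS : Tendsto (fun n => ‖S n‖) atTop atTop) {p : ℕ} (hp : ((p : ℝ) : EReal) ≤ exponent S) {s : ℂ}
    (h0 : exponent S < ((s.re : ℝ) : EReal)) (h1 : s.re < p + 1) :
    HasMellin (regLogGamma S p) (-s)
      (-(zetaSeries S s * (Real.pi / (s * Complex.sin (Real.pi * s))))) := by
  have hps : (p : ℝ) < s.re := EReal.coe_lt_coe_iff.1 (hp.trans_lt h0)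
  have hs := summable_norm_rpow hS h0
  -- Growth `O(x^q)` with `exponent S < q < Re s` gives convergence at infinity; the bound
  -- `O(x^(p+1))` gives it at `0`.
  obtain ⟨q, hq1, hq2⟩ := EReal.lt_iff_exists_real_btwn.1 h0
  have hpq : (p : ℝ) < q := EReal.coe_lt_coe_iff.1 (hp.trans_lt hq1)
  have hqs : q < s.re := EReal.coe_lt_coe_iff.1 hq2
  have hs1 : Summable fun n => ‖S n‖ ^ (-((p : ℝ) + 1)) :=
    summable_norm_rpow hS (h0.trans (EReal.coe_lt_coe_iff.2 h1))
  obtain ⟨C, hC⟩ := exists_integral_norm_logKernel_div_le p hps h1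
  refine ⟨mellinConvergent_of_isBigO_rpow (a := -q) (b := -(p + 1))
    ((continuousOn_regLogGamma hre hs1).locallyIntegrableOn measurableSet_Ioi) ?_ ?_ ?_ ?_, ?_⟩
  · rw [neg_neg]
    exact isBigO_regLogGamma hre hpq (by linarith) (summable_norm_rpow hS hq1)
      (eventually_gt_atTop 0)
  · rw [Complex.neg_re]
    linarith
  · rw [neg_neg]
    exact isBigO_regLogGamma hre (by linarith) le_rfl hs1 self_mem_nhdsWithin
  · rw [Complex.neg_re]
    linarith
  · have hsum := hasSum_integral_of_summable_integral_norm (μ := volume.restrict (Ioi (0 : ℝ)))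
      (F := fun n (x : ℝ) => (x : ℂ) ^ (-s - 1) • logKernel p (x / S n))
      (fun n => mellinConvergent_logKernel_div p (hre n) hps h1)
      (Summable.of_nonneg_of_le (fun n => integral_nonneg fun _ => norm_nonneg _)
        (fun n => hC _ (hre n)) (hs.mul_left C))
    have hterm : ∀ n, ∫ x in Ioi (0 : ℝ), (x : ℂ) ^ (-s - 1) • logKernel p (x / S n) =
        S n ^ (-s) * (Real.pi / (s * Complex.sin (Real.pi * s))) := fun n =>
      mellin_logKernel_div p (hre n) hps h1
    simp_rw [hterm] at hsum
    rw [zetaSeries, ← tsum_mul_right, hsum.tsum_eq, ← integral_neg, mellin]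
    refine setIntegral_congr_fun measurableSet_Ioi fun x hx => ?_
    simp only [regLogGamma, smul_eq_mul, tsum_mul_left, mul_neg]

end

/-! ### Power-logarithm terms and the splitting of the Mellin integral at `1` -/

/-- The function `(c₀ + c₁ log x) x ^ β` on the positive half-line. -/
def powLog (c₀ c₁ : ℂ) (β : ℝ) (x : ℝ) : ℂ := (c₀ + c₁ * Real.log x) * (x : ℂ) ^ (β : ℂ)

theorem isBigO_coeff_of_powLog {c₀ c₁ : ℂ} {β : ℝ} {l : Filter ℝ} (hl : ∀ᶠ x in l, 0 < x)
    {g : ℝ → ℝ} (h : powLog c₀ c₁ β =O[l] fun x => g x * x ^ β) :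
    (fun x : ℝ => c₀ + c₁ * Real.log x) =O[l] g := by
  obtain ⟨C, hC⟩ := h.bound
  refine IsBigO.of_bound C ?_
  filter_upwards [hC, hl] with x hx hx0
  have h1 : 0 < x ^ β := by positivity
  rw [powLog, norm_mul, norm_ofReal_cpow hx0, Complex.ofReal_re, norm_mul,
    Real.norm_of_nonneg h1.le, ← mul_assoc] at hx
  exact le_of_mul_le_mul_right hx h1

theorem log_coeff_eq_zero {c₀ c₁ : ℂ} {β : ℝ}
    (h : powLog c₀ c₁ β =O[atTop] fun x : ℝ => x ^ β) : c₁ = 0 := by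
  have h1 := isBigO_coeff_of_powLog (g := fun _ => 1) (eventually_gt_atTop 0) (by simpa using h)
  by_contra hc
  have h2 : (fun x : ℝ => c₁ * Real.log x) =O[atTop] fun _ : ℝ => (1 : ℝ) := by
    have := h1.sub (isBigO_const_const c₀ one_ne_zero atTop)
    simpa using this
  have h3 : Real.log =O[atTop] fun _ : ℝ => (1 : ℝ) := by
    obtain ⟨C, hC⟩ := h2.bound
    refine IsBigO.of_bound (C / ‖c₁‖) ?_
    filter_upwards [hC] with x hx
    have hc0 : 0 < ‖c₁‖ := norm_pos_iff.2 hc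
    rw [norm_mul, Complex.norm_real] at hx
    rw [div_mul_eq_mul_div, le_div_iff₀ hc0, mul_comm]
    exact hx
  exact (Real.isLittleO_const_log_atTop (c := 1)).not_isBigO
    (Eventually.frequently (Eventually.of_forall fun _ => one_ne_zero)) h3

theorem coeffs_eq_zero {c₀ c₁ : ℂ} {β : ℝ}
    (h : powLog c₀ c₁ β =o[atTop] fun x : ℝ => x ^ β) : c₀ = 0 ∧ c₁ = 0 := by
  have h1 := log_coeff_eq_zero h.isBigO
  refine ⟨?_, h1⟩
  subst h1
  have h2 : (fun _ : ℝ => c₀) =o[atTop] fun _ : ℝ => (1 : ℝ) := by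
    refine IsLittleO.of_bound fun ε hε => ?_
    filter_upwards [h.bound hε, eventually_gt_atTop 0] with x hx hx0
    have h1 : 0 < x ^ β := by positivity
    rw [powLog, norm_mul, norm_ofReal_cpow hx0, Complex.ofReal_re, zero_mul, add_zero,
      Real.norm_of_nonneg h1.le] at hx
    simpa using le_of_mul_le_mul_right hx h1
  simpa using h2

theorem continuousOn_powLog (c₀ c₁ : ℂ) (β : ℝ) : ContinuousOn (powLog c₀ c₁ β) (Ioi 0) := by
  refine ContinuousOn.mul ?_ (continuousOn_ofReal_cpow _)
  refine continuousOn_const.add (continuousOn_const.mul ?_)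
  exact Complex.continuous_ofReal.comp_continuousOn
    (Real.continuousOn_log.mono fun x hx => ne_of_gt hx)

/-- The Mellin transform over `(1, ∞)`, at `-s`. -/
def tailMellin (f : ℝ → ℂ) (s : ℂ) : ℂ := mellin ((Ioi 1).indicator f) (-s)

theorem locallyIntegrableOn_indicator {f : ℝ → ℂ} (hf : ContinuousOn f (Ioi 0)) {T : Set ℝ}
    (hT : MeasurableSet T) : LocallyIntegrableOn (T.indicator f) (Ioi 0) := fun x hx => by
  obtain ⟨U, hU, hi⟩ := hf.locallyIntegrableOn (μ := volume) measurableSet_Ioi x hx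
  exact ⟨U, hU, hi.indicator hT⟩

theorem isBigO_tail_zero (f : ℝ → ℂ) (b : ℝ) :
    (Ioi (1 : ℝ)).indicator f =O[𝓝[>] 0] fun x => x ^ (-b) := by
  refine IsBigO.of_bound 1 ?_
  filter_upwards [mem_nhdsWithin_of_mem_nhds (Iio_mem_nhds (zero_lt_one' ℝ))] with x hx
  have hx1 : x ∉ Ioi (1 : ℝ) := fun h => lt_asymm (mem_Iio.1 hx) (mem_Ioi.1 h)
  rw [indicator_of_notMem hx1]
  simp

theorem isBigO_tail_top {f : ℝ → ℂ} {β : ℝ} (h : f =O[atTop] fun x => x ^ β) :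
    (Ioi (1 : ℝ)).indicator f =O[atTop] fun x => x ^ (-(-β)) := by
  rw [neg_neg]
  refine h.congr' ?_ EventuallyEq.rfl
  filter_upwards [eventually_gt_atTop 1] with x hx
  rw [indicator_of_mem (mem_Ioi.2 hx)]

theorem mellinConvergent_tail {f : ℝ → ℂ} (hf : ContinuousOn f (Ioi 0)) {β : ℝ}
    (h : f =O[atTop] fun x => x ^ β) {s : ℂ} (hs : β < s.re) :
    MellinConvergent ((Ioi 1).indicator f) (-s) :=
  -- The truncated function vanishes near `0`, so any exponent may be used there; `(-s).re - 1` is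
  -- one that lies to the left of `(-s).re`.
  mellinConvergent_of_isBigO_rpow (locallyIntegrableOn_indicator hf measurableSet_Ioi)
    (isBigO_tail_top h) (by rw [Complex.neg_re]; linarith) (isBigO_tail_zero f ((-s).re - 1))
    (by linarith)

theorem analyticAt_tailMellin {f : ℝ → ℂ} (hf : ContinuousOn f (Ioi 0)) {β : ℝ}
    (h : f =O[atTop] fun x => x ^ β) {s : ℂ} (hs : β < s.re) : AnalyticAt ℂ (tailMellin f) s := by
  have hopen : IsOpen {z : ℂ | β < z.re} := isOpen_lt continuous_const Complex.continuous_re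
  refine DifferentiableOn.analyticAt (s := {z : ℂ | β < z.re}) (fun z hz => ?_)
    (hopen.mem_nhds hs)
  have hz : β < z.re := hz
  have := mellin_differentiableAt_of_isBigO_rpow (s := -z)
    (locallyIntegrableOn_indicator hf measurableSet_Ioi)
    (isBigO_tail_top h) (by rw [Complex.neg_re]; linarith) (isBigO_tail_zero f ((-z).re - 1))
    (by linarith)
  exact (this.comp z differentiableAt_id.neg).differentiableWithinAt

/-- The Mellin transform over `(0, 1]`, at `-s`. -/
def headMellin (f : ℝ → ℂ) (s : ℂ) : ℂ := mellin ((Ioc 0 1).indicator f) (-s)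

theorem analyticAt_headMellin {f : ℝ → ℂ} (hf : ContinuousOn f (Ioi 0)) {β : ℝ}
    (h : f =O[𝓝[>] 0] fun x => x ^ β) {s : ℂ} (hs : s.re < β) : AnalyticAt ℂ (headMellin f) s := by
  have hopen : IsOpen {z : ℂ | z.re < β} := isOpen_lt Complex.continuous_re continuous_const
  refine DifferentiableOn.analyticAt (s := {z : ℂ | z.re < β}) (fun z hz => ?_)
    (hopen.mem_nhds hs)
  have hz : z.re < β := hz
  have h1 : (Ioc (0 : ℝ) 1).indicator f =O[atTop] fun x => x ^ (-((-z).re + 1)) := by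
    refine IsBigO.of_bound 1 ?_
    filter_upwards [eventually_gt_atTop 1] with x hx
    rw [indicator_of_notMem (fun h => absurd hx (not_lt.2 h.2))]
    simp
  have h2 : (Ioc (0 : ℝ) 1).indicator f =O[𝓝[>] 0] fun x => x ^ (-(-β)) := by
    rw [neg_neg]
    refine h.congr' ?_ EventuallyEq.rfl
    filter_upwards [Ioc_mem_nhdsGT (zero_lt_one' ℝ)] with x hx
    rw [indicator_of_mem hx]
  have := mellin_differentiableAt_of_isBigO_rpow (s := -z)
    (locallyIntegrableOn_indicator hf measurableSet_Ioc) h1 (by linarith) h2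
    (by rw [Complex.neg_re]; linarith)
  exact (this.comp z differentiableAt_id.neg).differentiableWithinAt

theorem mellin_eq_head_add_tail {f : ℝ → ℂ} {s : ℂ} (h : MellinConvergent f (-s)) :
    MellinConvergent ((Ioi 1).indicator f) (-s) ∧ mellin f (-s) = headMellin f s + tailMellin f s := by
  have h1 : MellinConvergent ((Ioi 1).indicator f) (-s) := by
    have := Integrable.indicator h (measurableSet_Ioi (a := (1 : ℝ)))
    refine this.congr (ae_of_all _ fun x => ?_)
    simp only [indicator_smul]
  have h2 : MellinConvergent ((Ioc 0 1).indicator f) (-s) := by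
    have := Integrable.indicator h (measurableSet_Ioc (a := (0 : ℝ)) (b := 1))
    refine this.congr (ae_of_all _ fun x => ?_)
    simp only [indicator_smul]
  refine ⟨h1, ?_⟩
  rw [headMellin, tailMellin, ← (hasMellin_add h2 h1).2]
  refine setIntegral_congr_fun measurableSet_Ioi fun x hx => ?_
  have hx0 : 0 < x := hx
  rcases le_or_gt x 1 with hx1 | hx1
  · simp [hx1, hx0]
  · simp [hx1, not_le.2 hx1]

theorem isBigO_cpow_tail (β : ℝ) :
    (fun x : ℝ => (x : ℂ) ^ (β : ℂ)) =O[atTop] fun x : ℝ => x ^ β := by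
  refine IsBigO.of_bound 1 ?_
  filter_upwards [eventually_gt_atTop 0] with x hx
  rw [norm_ofReal_cpow hx, Complex.ofReal_re, one_mul, Real.norm_of_nonneg (by positivity)]

theorem sub_ofReal_ne_zero {s : ℂ} {β : ℝ} (hs : β < s.re) : s - β ≠ 0 := fun h => by
  have := congrArg Complex.re h
  simp at this
  linarith

theorem tailMellin_cpow {β : ℝ} {s : ℂ} (hs : β < s.re) :
    tailMellin (fun x : ℝ => (x : ℂ) ^ (β : ℂ)) s = 1 / (s - β) := by
  have h1 : ∀ x ∈ Ioi (0 : ℝ), (x : ℂ) ^ (-s - 1) •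
      (Ioi (1 : ℝ)).indicator (fun x : ℝ => (x : ℂ) ^ (β : ℂ)) x =
      (Ioi (1 : ℝ)).indicator (fun x : ℝ => (x : ℂ) ^ (β - s - 1 : ℂ)) x := by
    intro x hx
    have hx0 : (x : ℂ) ≠ 0 := Complex.ofReal_ne_zero.2 (ne_of_gt hx)
    by_cases hx1 : x ∈ Ioi (1 : ℝ)
    · rw [indicator_of_mem hx1, indicator_of_mem hx1, smul_eq_mul, ← Complex.cpow_add _ _ hx0]
      congr 1
      ring
    · rw [indicator_of_notMem hx1, indicator_of_notMem hx1, smul_zero]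
  rw [tailMellin, mellin, setIntegral_congr_fun measurableSet_Ioi h1,
    setIntegral_indicator measurableSet_Ioi, Ioi_inter_Ioi, max_eq_right zero_le_one,
    integral_Ioi_cpow_of_lt (by simp; linarith) one_pos]
  have h2 : (β : ℂ) - s - 1 + 1 = -(s - β) := by ring
  rw [h2, Complex.ofReal_one, Complex.one_cpow, neg_div_neg_eq]

/-- Differentiating a Mellin transform in its variable inserts `log x`, so the logarithmic term is
the derivative of the transform `1/(s-β)` of the pure power. -/
theorem hasMellin_tail_powLog (c₀ c₁ : ℂ) {β : ℝ} {s : ℂ} (hs : β < s.re) :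
    HasMellin ((Ioi 1).indicator (powLog c₀ c₁ β)) (-s) (c₀ / (s - β) + c₁ / (s - β) ^ 2) := by
  have hcont : ContinuousOn (fun x : ℝ => (x : ℂ) ^ (β : ℂ)) (Ioi 0) := continuousOn_ofReal_cpow _
  have h0 := mellinConvergent_tail hcont (isBigO_cpow_tail β) hs
  have hd := mellin_hasDerivAt_of_isBigO_rpow (s := -s)
    (locallyIntegrableOn_indicator hcont measurableSet_Ioi)
    (isBigO_tail_top (isBigO_cpow_tail β)) (by rw [Complex.neg_re]; linarith)
    (isBigO_tail_zero _ ((-s).re - 1)) (by linarith)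
  have hne := sub_ofReal_ne_zero hs
  have hval : mellin (fun t : ℝ => Real.log t •
      (Ioi (1 : ℝ)).indicator (fun x : ℝ => (x : ℂ) ^ (β : ℂ)) t) (-s) = 1 / (s - β) ^ 2 := by
    refine hd.2.unique ?_
    have h1 : HasDerivAt (fun z : ℂ => 1 / (-z - β)) (1 / (s - β) ^ 2) (-s) := by
      have hne' : - -s - (β : ℂ) ≠ 0 := by rwa [neg_neg]
      have := ((((hasDerivAt_id (-s)).neg).sub_const (β : ℂ)).inv hne')
      convert! this using 1
      · funext z
        simp
      · simp
    refine h1.congr_of_eventuallyEq ?_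
    have hopen : IsOpen {z : ℂ | β < -z.re} := isOpen_lt continuous_const
      Complex.continuous_re.neg
    filter_upwards [hopen.mem_nhds (show β < -(-s).re by simpa using hs)] with z hz
    have := tailMellin_cpow (s := -z) (by simpa using hz)
    simpa [tailMellin] using this
  have h2 := hasMellin_add (h0.const_smul c₀) (hd.1.const_smul c₁)
  rw [(hasMellin_const_smul h0 c₀).2, (hasMellin_const_smul hd.1 c₁).2, hval] at h2
  have h3 := tailMellin_cpow hs
  rw [tailMellin] at h3
  rw [h3, smul_eq_mul, smul_eq_mul, mul_one_div, mul_one_div] at h2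
  convert h2 using 1
  funext x
  by_cases hx : x ∈ Ioi (1 : ℝ)
  · simp only [indicator_of_mem hx, powLog, smul_eq_mul, Complex.real_smul]
    ring
  · simp only [indicator_of_notMem hx, smul_zero, add_zero]

/-- The first alternative in `h` admits terms whose exponent lies to the right of `s`, provided that
their coefficients vanish; such terms occur formally in the expansion. -/
theorem hasMellin_tail_add_sum {ι : Type*} (F : Finset ι) (c₀ c₁ : ι → ℂ) (β : ι → ℝ) {s : ℂ}
    (h : ∀ j ∈ F, (c₀ j = 0 ∧ c₁ j = 0) ∨ β j < s.re) {f : ℝ → ℂ}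
    (hf : MellinConvergent ((Ioi 1).indicator f) (-s)) :
    HasMellin ((Ioi 1).indicator fun x => f x + ∑ j ∈ F, powLog (c₀ j) (c₁ j) (β j) x) (-s)
      (tailMellin f s + ∑ j ∈ F, (c₀ j / (s - β j) + c₁ j / (s - β j) ^ 2)) := by
  classical
  induction F using Finset.induction_on with
  | empty => simpa using ⟨hf, rfl⟩
  | insert j F hj ih =>
    have h1 := ih fun i hi => h i (Finset.mem_insert_of_mem hi)
    have h2 : HasMellin ((Ioi 1).indicator (powLog (c₀ j) (c₁ j) (β j))) (-s)
        (c₀ j / (s - β j) + c₁ j / (s - β j) ^ 2) := by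
      rcases h j (Finset.mem_insert_self _ _) with h3 | h3
      · have h4 : powLog (c₀ j) (c₁ j) (β j) = fun _ => 0 := by
          funext x
          simp [powLog, h3.1, h3.2]
        rw [h4, h3.1, h3.2, indicator_zero]
        refine ⟨?_, by simp [mellin]⟩
        simp [MellinConvergent]
      · exact hasMellin_tail_powLog _ _ h3
    have h5 := hasMellin_add h1.1 h2.1
    rw [h1.2, h2.2] at h5
    convert h5 using 1
    · funext x
      by_cases hx : x ∈ Ioi (1 : ℝ)
      · simp only [indicator_of_mem hx, Finset.sum_insert hj]
        ring
      · simp only [indicator_of_notMem hx, add_zero]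
    · rw [Finset.sum_insert hj]
      ring

/-! ### The expansion of `log Γ` on the positive axis -/

section

variable {S : ℕ → ℂ} {θ c : ℝ} {N : ℕ∞} {α : ℕ → ℝ} {a : ℕ → ℕ →₀ ℂ}

theorem IsSpectralType.re_pos (hS : IsSpectralType S θ c N α a) (n : ℕ) : 0 < (S n).re :=
  re_pos_of_mem_interior_sector hS.c_pos hS.θ_lt_pi (hS.mem_sector n)

/-- The remainder of `log Γ(x, S)` on the positive half-line. -/
def axisRemainder (S : ℕ → ℂ) (α : ℕ → ℝ) (a : ℕ → ℕ →₀ ℂ) (M : ℕ) (x : ℝ) : ℂ :=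
  regLogGamma S (genus S) x - ∑ j ∈ Finset.range (M + 1), powLog (a j 0) (a j 1) (α j) x

theorem IsTotallyRegular.axisRemainder_eq (hS : IsTotallyRegular S θ c N α a) {M : ℕ}
    (hM : (M : ℕ∞) ≤ N) {x : ℝ} (hx : 0 < x) :
    axisRemainder S α a M x = remainder S α a M (-x) := by
  rw [axisRemainder, remainder, regLogGamma_genus, neg_neg]
  congr 1
  refine Finset.sum_congr rfl fun j hj => ?_
  have hjM : j ≤ M := Nat.lt_succ_iff.1 (Finset.mem_range.1 hj)
  have hjN : (j : ℕ∞) ≤ N := (Nat.cast_le.2 hjM).trans hM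
  rw [Finsupp.sum_of_support_subset (a j) (s := {0, 1}) (fun k hk => by
    by_contra h
    simp only [Finset.mem_insert, Finset.mem_singleton, not_or] at h
    exact Finsupp.mem_support_iff.1 hk (hS.coeff_eq_zero j hjN k h.1 h.2)) _ (by simp),
    Finset.sum_pair zero_ne_one, powLog, Complex.ofReal_log hx.le]
  ring

theorem IsTotallyRegular.isBigO_axisRemainder (hS : IsTotallyRegular S θ c N α a) {M : ℕ}
    (hM : (M : ℕ∞) ≤ N) {β : ℝ}
    (h : remainder S α a M =O[atInfinity θ c] fun l : ℂ => ‖l‖ ^ β) :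
    axisRemainder S α a M =O[atTop] fun x : ℝ => x ^ β := by
  refine (h.comp_tendsto (tendsto_neg_ofReal_atInfinity hS.c_pos hS.θ_lt_pi)).congr' ?_ ?_
  · filter_upwards [eventually_gt_atTop 0] with x hx
    exact (hS.axisRemainder_eq hM hx).symm
  · filter_upwards [eventually_gt_atTop 0] with x hx
    simp [abs_of_pos hx]

theorem IsTotallyRegular.isLittleO_axisRemainder (hS : IsTotallyRegular S θ c N α a) {M : ℕ}
    (hM : (M : ℕ∞) ≤ N) : axisRemainder S α a M =o[atTop] fun x : ℝ => x ^ α M := by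
  refine ((hS.expansion M hM).comp_tendsto
    (tendsto_neg_ofReal_atInfinity hS.c_pos hS.θ_lt_pi)).congr' ?_ ?_
  · filter_upwards [eventually_gt_atTop 0] with x hx
    exact (hS.axisRemainder_eq hM hx).symm
  · filter_upwards [eventually_gt_atTop 0] with x hx
    simp [abs_of_pos hx]

theorem isLittleO_rpow_rpow {p q : ℝ} (h : p < q) :
    (fun x : ℝ => x ^ p) =o[atTop] fun x => x ^ q := by
  refine isLittleO_of_tendsto' ?_ ?_
  · filter_upwards [eventually_gt_atTop 0] with x hx hx0
    exact absurd hx0 (by positivity)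
  · refine (tendsto_rpow_neg_atTop (sub_pos.2 h)).congr' ?_
    filter_upwards [eventually_gt_atTop 0] with x hx
    rw [← Real.rpow_sub hx]
    congr 1
    ring

/-- The growth of `log Γ` bounds the exponents of the nonzero terms of the expansion. -/
theorem IsTotallyRegular.coeffs_of_isBigO (hS : IsTotallyRegular S θ c N α a) {q : ℝ}
    (h : regLogGamma S (genus S) =O[atTop] fun x : ℝ => x ^ q) (j : ℕ) (hj : (j : ℕ∞) ≤ N) :
    (q < α j → a j 0 = 0 ∧ a j 1 = 0) ∧ (q ≤ α j → a j 1 = 0) := by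
  induction j using Nat.strong_induction_on with
  | _ j ih =>
    -- Earlier exponents are strictly larger, hence exceed `q`, and by induction their terms vanish.
    -- So the `j`-th term is the difference of `log Γ` and the `j`-th remainder.
    have key : q ≤ α j → powLog (a j 0) (a j 1) (α j) =
        fun x => regLogGamma S (genus S) x - axisRemainder S α a j x := by
      intro hq
      funext x
      rw [axisRemainder, Finset.sum_range_succ, Finset.sum_eq_zero fun i hi => ?_]
      · ring
      · have hij := Finset.mem_range.1 hi
        have h1 := (ih i hij ((Nat.cast_le.2 hij.le).trans hj)).1
          (hq.trans_lt (hS.exponents_lt i j hij hj))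
        simp [powLog, h1.1, h1.2]
    refine ⟨fun hq => coeffs_eq_zero (β := α j) ?_, fun hq => log_coeff_eq_zero (β := α j) (c₀ := a j 0) ?_⟩
    · rw [key hq.le]
      exact (h.trans_isLittleO (isLittleO_rpow_rpow hq)).sub (hS.isLittleO_axisRemainder hj)
    · rw [key hq]
      refine (h.trans ?_).sub (hS.isLittleO_axisRemainder hj).isBigO
      rcases hq.eq_or_lt with h1 | h1
      · rw [h1]
        exact isBigO_refl _ _
      · exact (isLittleO_rpow_rpow h1).isBigO

/-- The degree `p` lies below the exponent of convergence, which lies below `p + 1`, and passing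
from the genus to `p` adds the term `κ x ^ (g + 1)`. -/
structure IsRegDegree (S : ℕ → ℂ) (p : ℕ) (κ : ℂ) : Prop where
  le_exponent : ((p : ℝ) : EReal) ≤ exponent S
  exponent_lt : exponent S < ((p + 1 : ℝ) : EReal)
  genus_le : genus S ≤ p
  reg_eq : ∀ x : ℝ, 0 < x → regLogGamma S p x =
    regLogGamma S (genus S) x + powLog κ 0 ((genus S : ℝ) + 1) x
  eq_zero_or : κ = 0 ∨ p = genus S + 1

theorem IsSpectralType.summable_genus_rpow (hS : IsSpectralType S θ c N α a) :
    Summable fun n => ‖S n‖ ^ (-((genus S : ℝ) + 1)) := by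
  refine (summable_genus hS.tendsto_norm hS.exponent_lt_top).congr fun n => ?_
  rw [Real.rpow_neg (norm_nonneg _)]
  norm_cast

/-- The exponent lies in `[g, g + 1]`, so degree `g` with `κ = 0` works unless the exponent equals
`g + 1`; in that case degree `g + 1` is used. -/
theorem IsSpectralType.exists_isRegDegree (hS : IsSpectralType S θ c N α a) :
    ∃ p κ, IsRegDegree S p κ := by
  have hg := genus_le_exponent hS.tendsto_norm
  have hle := exponent_le_of_summable hS.ne_zero hS.monotone_norm hS.tendsto_norm
    (summable_genus hS.tendsto_norm hS.exponent_lt_top)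
  rcases hle.lt_or_eq with h | h
  · exact ⟨genus S, 0, hg, h, le_rfl, fun x _ => by simp [powLog], Or.inl rfl⟩
  · refine ⟨genus S + 1, -((-1) ^ (genus S + 1) / ((genus S + 1 : ℕ) : ℂ) *
      ∑' n, (S n ^ (genus S + 1))⁻¹), ?_, ?_, Nat.le_succ _, fun x hx => ?_, Or.inr rfl⟩
    rotate_left 2
    · rw [regLogGamma_succ hS.re_pos hS.summable_genus_rpow hx, powLog, zero_mul, add_zero]
      congr 2
      have : (((genus S : ℝ) + 1 : ℝ) : ℂ) = ((genus S + 1 : ℕ) : ℂ) := by push_cast; rfl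
      rw [this, Complex.cpow_natCast]
    · rw [h]
      push_cast
      exact le_rfl
    · rw [h]
      refine EReal.coe_lt_coe_iff.2 ?_
      push_cast
      linarith

theorem IsSpectralType.isBigO_genus (hS : IsSpectralType S θ c N α a) :
    regLogGamma S (genus S) =O[atTop] fun x : ℝ => x ^ ((genus S : ℝ) + 1) :=
  isBigO_regLogGamma hS.re_pos (by linarith) le_rfl hS.summable_genus_rpow (eventually_gt_atTop 0)

theorem IsSpectralType.exists_isBigO (hS : IsSpectralType S θ c N α a) {p : ℕ} {κ : ℂ}
    (hp : IsRegDegree S p κ) {r : ℝ} (hr : exponent S < (r : EReal)) :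
    ∃ q < r, regLogGamma S (genus S) =O[atTop] fun x : ℝ => x ^ q := by
  obtain ⟨q, hq1, hq2⟩ := EReal.lt_iff_exists_real_btwn.1 (lt_min hr hp.exponent_lt)
  have hqr : q < r := EReal.coe_lt_coe_iff.1 (hq2.trans_le (min_le_left _ _))
  have hqp : q < p + 1 := EReal.coe_lt_coe_iff.1 (hq2.trans_le (min_le_right _ _))
  have hpq : (p : ℝ) < q := EReal.coe_lt_coe_iff.1 (hp.le_exponent.trans_lt hq1)
  refine ⟨q, hqr, ?_⟩
  have h1 := isBigO_regLogGamma hS.re_pos hpq hqp.le (summable_norm_rpow hS.tendsto_norm hq1)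
    (eventually_gt_atTop 0)
  have h2 : powLog κ 0 ((genus S : ℝ) + 1) =O[atTop] fun x : ℝ => x ^ q := by
    rcases hp.eq_zero_or with h0 | h0
    · subst h0
      have : powLog 0 0 ((genus S : ℝ) + 1) = fun _ => 0 := by
        funext x
        simp [powLog]
      rw [this]
      exact isBigO_zero _ _
    -- The correction occurs only for `p = g + 1`, and `p < q`, so it is absorbed in `O(x^q)`.
    · have h3 : (genus S : ℝ) + 1 < q := by
        rw [h0] at hpq
        exact_mod_cast hpq
      have h4 : powLog κ 0 ((genus S : ℝ) + 1) =
          fun x : ℝ => κ * (x : ℂ) ^ ((((genus S : ℝ) + 1 : ℝ)) : ℂ) := by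
        funext x
        simp [powLog]
      rw [h4]
      exact ((isBigO_cpow_tail _).const_mul_left κ).trans (isLittleO_rpow_rpow h3).isBigO
  refine (h1.sub h2).congr' ?_ EventuallyEq.rfl
  filter_upwards [eventually_gt_atTop 0] with x hx
  rw [hp.reg_eq x hx]
  ring

theorem IsTotallyRegular.coeffs_eq_zero_of_exponent_lt (hS : IsTotallyRegular S θ c N α a) {p : ℕ}
    {κ : ℂ} (hp : IsRegDegree S p κ) {j : ℕ} (hj : (j : ℕ∞) ≤ N)
    (h : exponent S < ((α j : ℝ) : EReal)) : a j 0 = 0 ∧ a j 1 = 0 := by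
  obtain ⟨q, hq, hO⟩ := hS.exists_isBigO hp h
  exact (hS.coeffs_of_isBigO hO j hj).1 hq

theorem IsTotallyRegular.log_coeff_eq_zero_of_genus_lt (hS : IsTotallyRegular S θ c N α a)
    {j : ℕ} (hj : (j : ℕ∞) ≤ N) (h : (genus S : ℝ) + 1 ≤ α j) : a j 1 = 0 :=
  (hS.coeffs_of_isBigO hS.isBigO_genus j hj).2 h

/-- The part of the Mellin transform of the regularized `log Γ` that comes from the principal
terms of the expansion and the remainder. -/
def mellinAux (S : ℕ → ℂ) (α : ℕ → ℝ) (a : ℕ → ℕ →₀ ℂ) (p : ℕ) (κ : ℂ) (M : ℕ) (s : ℂ) : ℂ :=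
  headMellin (regLogGamma S p) s + κ / (s - ((genus S : ℝ) + 1 : ℝ)) +
    (tailMellin (axisRemainder S α a M) s +
      ∑ j ∈ Finset.range (M + 1), (a j 0 / (s - α j) + a j 1 / (s - α j) ^ 2))

theorem IsSpectralType.continuousOn_axisRemainder (hS : IsSpectralType S θ c N α a) (M : ℕ) :
    ContinuousOn (axisRemainder S α a M) (Ioi 0) :=
  (continuousOn_regLogGamma hS.re_pos hS.summable_genus_rpow).sub
    (continuousOn_finsetSum _ fun _ _ => continuousOn_powLog _ _ _)

theorem tailMellin_congr {f g : ℝ → ℂ} (h : ∀ x : ℝ, 1 < x → f x = g x) (s : ℂ) :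
    tailMellin f s = tailMellin g s := by
  have : (Ioi (1 : ℝ)).indicator f = (Ioi (1 : ℝ)).indicator g := by
    funext x
    by_cases hx : x ∈ Ioi (1 : ℝ)
    · rw [indicator_of_mem hx, indicator_of_mem hx, h x hx]
    · rw [indicator_of_notMem hx, indicator_of_notMem hx]
  rw [tailMellin, tailMellin, this]

/-- The two remainders differ by the terms `M < j ≤ M'`, and the tail transforms of these are
exactly the added fractions. Hence continuations from different truncations agree. -/
theorem IsSpectralType.mellinAux_eq_of_le (hS : IsSpectralType S θ c N α a) (p : ℕ) (κ : ℂ)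
    {M M' : ℕ} (hMM : M ≤ M') {β : ℝ}
    (hM' : axisRemainder S α a M' =O[atTop] fun x : ℝ => x ^ β) {s : ℂ} (hβ : β < s.re)
    (hα : ∀ j, M < j → j ≤ M' → α j < s.re) :
    mellinAux S α a p κ M s = mellinAux S α a p κ M' s := by
  have h1 := hasMellin_tail_add_sum (Finset.Ico (M + 1) (M' + 1)) (fun j => a j 0) (fun j => a j 1)
    α (s := s) (fun j hj => Or.inr (by
      have := Finset.mem_Ico.1 hj
      exact hα j (by omega) (by omega)))
    (mellinConvergent_tail (hS.continuousOn_axisRemainder M') hM' hβ)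
  have h2 : tailMellin (axisRemainder S α a M) s = _ := (tailMellin_congr (fun x _ => by
    rw [axisRemainder, axisRemainder,
      ← Finset.sum_range_add_sum_Ico _ (Nat.succ_le_succ hMM)]
    ring) s).trans h1.2
  rw [mellinAux, mellinAux, h2, ← Finset.sum_range_add_sum_Ico _ (Nat.succ_le_succ hMM)]
  ring

theorem IsTotallyRegular.mellinAux_eq (hS : IsTotallyRegular S θ c N α a) {p : ℕ} {κ : ℂ}
    (hp : IsRegDegree S p κ) {M : ℕ} (hMN : (M : ℕ∞) ≤ N) {β : ℝ}
    (hM : axisRemainder S α a M =O[atTop] fun x : ℝ => x ^ β) {s : ℂ} (hβ : β < s.re)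
    (h0 : exponent S < ((s.re : ℝ) : EReal)) (h1 : s.re < p + 1) :
    mellinAux S α a p κ M s = -(zetaSeries S s * (Real.pi / (s * Complex.sin (Real.pi * s)))) := by
  have hm := mellin_regLogGamma hS.re_pos hS.tendsto_norm hp.le_exponent h0 h1
  have h2 := (mellin_eq_head_add_tail hm.1).2
  rw [hm.2] at h2
  have h3 := hasMellin_tail_add_sum (Finset.range (M + 1)) (fun j => a j 0) (fun j => a j 1)
    α (s := s) (fun j hj => by
      have hjM : j ≤ M := Nat.lt_succ_iff.1 (Finset.mem_range.1 hj)
      -- An exponent above the exponent of convergence carries zero coefficients; any other lies to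
      -- the left of `s`.
      by_cases hj' : exponent S < ((α j : ℝ) : EReal)
      · exact Or.inl (hS.coeffs_eq_zero_of_exponent_lt hp ((Nat.cast_le.2 hjM).trans hMN) hj')
      · exact Or.inr (EReal.coe_lt_coe_iff.1 ((not_lt.1 hj').trans_lt h0)))
    (mellinConvergent_tail (hS.continuousOn_axisRemainder M) hM hβ)
  have h4 := hasMellin_tail_add_sum {()} (fun _ => κ) (fun _ => 0) (fun _ => (genus S : ℝ) + 1)
    (s := s) (fun _ _ => by
      rcases hp.eq_zero_or with h5 | h5
      · exact Or.inl ⟨h5, rfl⟩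
      · refine Or.inr (EReal.coe_lt_coe_iff.1 (lt_of_le_of_lt ?_ h0))
        have := hp.le_exponent
        rw [h5] at this
        exact_mod_cast this) h3.1
  have h5 : tailMellin (regLogGamma S p) s = _ := (tailMellin_congr (fun x hx => by
    rw [hp.reg_eq x (by linarith), axisRemainder, Finset.sum_singleton]
    ring) s).trans h4.2
  rw [h2, h5, tailMellin, h3.2, mellinAux, Finset.sum_singleton]
  ring

end

/-! ### The sine factor, local Laurent data and removable singularities -/

theorem sin_eq_add_sq_mul : ∃ h : ℂ → ℂ, Differentiable ℂ h ∧ h 0 = 0 ∧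
    ∀ z, Complex.sin z = z + z ^ 2 * h z := by
  have hd : ∀ f : ℂ → ℂ, Differentiable ℂ f → Differentiable ℂ (dslope f 0) := fun f hf =>
    differentiableOn_univ.1 ((Complex.differentiableOn_dslope univ_mem).2 hf.differentiableOn)
  have h1 := hd _ Complex.differentiable_sin
  have hg0 : dslope Complex.sin 0 0 = 1 := by
    rw [dslope_same, Complex.deriv_sin, Complex.cos_zero]
  have hmul : ∀ (f : ℂ → ℂ) (z : ℂ), f z = f 0 + z * dslope f 0 z := fun f z => by
    have := sub_smul_dslope f 0 z
    rw [sub_zero, smul_eq_mul] at this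
    rw [this]
    ring
  -- Evenness of `sin z / z` removes its linear term, whence `h 0 = 0`; this keeps a correction from
  -- the sine out of the finite parts at integers.
  have heven : ∀ z, dslope Complex.sin 0 (-z) = dslope Complex.sin 0 z := fun z => by
    rcases eq_or_ne z 0 with rfl | hz
    · rw [neg_zero]
    · have h2 := hmul Complex.sin z
      have h3 := hmul Complex.sin (-z)
      rw [Complex.sin_neg, h2, Complex.sin_zero] at h3
      have h4 : z * dslope Complex.sin 0 (-z) = z * dslope Complex.sin 0 z := by
        linear_combination h3
      exact mul_left_cancel₀ hz h4
  refine ⟨dslope (dslope Complex.sin 0) 0, hd _ h1, ?_, fun z => ?_⟩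
  · have h2 := deriv_comp_neg (f := dslope Complex.sin 0) (x := (0 : ℂ))
    simp_rw [heven, neg_zero] at h2
    rw [dslope_same]
    exact self_eq_neg.1 h2
  · rw [hmul Complex.sin z, hmul (dslope Complex.sin 0) z, hg0, Complex.sin_zero]
    ring

/-- The reciprocal, up to sign, of the Mellin transform of the logarithm. -/
def sineFactor (s : ℂ) : ℂ := -(s * Complex.sin (Real.pi * s) / Real.pi)

theorem differentiable_sineFactor : Differentiable ℂ sineFactor := by
  unfold sineFactor
  fun_prop

theorem HasResidueAndFinitePart.congr {f g : ℂ → ℂ} {p r b : ℂ}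
    (hf : HasResidueAndFinitePart f p r b) (h : g =ᶠ[𝓝[≠] p] f) :
    HasResidueAndFinitePart g p r b := by
  obtain ⟨k, hk, hb, hfk⟩ := hf
  exact ⟨k, hk, hb, by filter_upwards [h, hfk] with s h1 h2; rw [h1, h2]⟩

/-- Near `m` the factor is `(-1)^(m+1) s (s-m) (1 + O((s-m)²))`. Its zero at `m` turns the double
pole into a simple one and kills the contribution of `K` to the finite part; writing `s = m + (s-m)`
produces the extra `c₂`. -/
theorem hasResidue_sineFactor_mul_int {F K : ℂ → ℂ} {m : ℤ} (hK : AnalyticAt ℂ K m) {c₁ c₂ : ℂ}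
    (hF : F =ᶠ[𝓝[≠] (m : ℂ)]
      fun s => sineFactor s * (K s + c₁ / (s - m) + c₂ / (s - m) ^ 2)) :
    HasResidueAndFinitePart F m ((-1) ^ (m + 1) * m * c₂) ((-1) ^ (m + 1) * (m * c₁ + c₂)) := by
  obtain ⟨h, hh, hh0, hsin⟩ := sin_eq_add_sq_mul
  have hpi : (Real.pi : ℂ) ≠ 0 := Complex.ofReal_ne_zero.2 Real.pi_ne_zero
  have hH : AnalyticAt ℂ (fun s : ℂ => h (Real.pi * (s - m))) m :=
    Differentiable.analyticAt (f := fun s : ℂ => h (Real.pi * (s - m)))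
      (hh.comp (by fun_prop)) _
  refine HasResidueAndFinitePart.congr ⟨fun s => (-1) ^ (m + 1) *
    (s * (1 + Real.pi * (s - m) * h (Real.pi * (s - m))) * ((s - m) * K s + c₁) +
      c₂ * (1 + s * (Real.pi * h (Real.pi * (s - m))))), ?_, ?_, ?_⟩ hF
  · have hsub : AnalyticAt ℂ (fun s : ℂ => s - m) m := analyticAt_id.sub analyticAt_const
    exact analyticAt_const.mul (((analyticAt_id.mul (analyticAt_const.add
      ((analyticAt_const.mul hsub).mul hH))).mul ((hsub.mul hK).add analyticAt_const)).add
      (analyticAt_const.mul (analyticAt_const.add (analyticAt_id.mul (analyticAt_const.mul hH)))))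
  · simp only [sub_self, mul_zero, hh0, zero_mul, add_zero, zero_add, mul_one]
  · filter_upwards [self_mem_nhdsWithin] with s hs
    have hs0 : s - m ≠ 0 := sub_ne_zero.2 hs
    have hsn : Complex.sin (Real.pi * s) = (-1) ^ m * Complex.sin (Real.pi * (s - m)) := by
      have : (Real.pi * s : ℂ) = Real.pi * (s - m) + m * Real.pi := by ring
      rw [this]
      have := Complex.sin_antiperiodic.add_int_mul_eq (x := Real.pi * (s - m)) m
      rw [this, Int.cast_negOnePow]
    rw [sineFactor, hsn, hsin, zpow_add₀ (by norm_num : (-1 : ℂ) ≠ 0), zpow_one]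
    field_simp
    ring

theorem hasResidue_sineFactor_mul {F K : ℂ → ℂ} {p : ℂ} (hK : AnalyticAt ℂ K p) {c₁ : ℂ}
    (hF : F =ᶠ[𝓝[≠] p] fun s => sineFactor s * (K s + c₁ / (s - p))) :
    ∃ b, HasResidueAndFinitePart F p (sineFactor p * c₁) b := by
  have hW : AnalyticAt ℂ (dslope sineFactor p) p :=
    Differentiable.analyticAt (differentiableOn_univ.1
      ((Complex.differentiableOn_dslope univ_mem).2 differentiable_sineFactor.differentiableOn)) _
  refine ⟨_, HasResidueAndFinitePart.congr ⟨fun s => sineFactor s * K s +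
    dslope sineFactor p s * c₁, ?_, rfl, ?_⟩ hF⟩
  · exact ((differentiable_sineFactor.analyticAt _).mul hK).add (hW.mul analyticAt_const)
  · filter_upwards [self_mem_nhdsWithin] with s hs
    have hs0 : s - p ≠ 0 := sub_ne_zero.2 hs
    have h1 := sub_smul_dslope sineFactor p s
    rw [smul_eq_mul] at h1
    have h2 : sineFactor s = sineFactor p + (s - p) * dslope sineFactor p s := by
      rw [h1]
      ring
    rw [h2]
    field_simp
    ring

/-- The reflection formula combined with `Γ(1-p) = -p Γ(-p)`. -/
theorem sineFactor_eq_inv_Gamma {p : ℂ} (h : ∀ m : ℤ, p ≠ m) :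
    sineFactor p = (Complex.Gamma p * Complex.Gamma (-p))⁻¹ := by
  have hp : p ≠ 0 := by simpa using h 0
  have hsin : Complex.sin (Real.pi * p) ≠ 0 := by
    rw [Ne, Complex.sin_eq_zero_iff]
    rintro ⟨k, hk⟩
    refine h k (mul_left_cancel₀ (Complex.ofReal_ne_zero.2 Real.pi_ne_zero) ?_)
    rw [hk, mul_comm]
  have hpi : (Real.pi : ℂ) ≠ 0 := Complex.ofReal_ne_zero.2 Real.pi_ne_zero
  have h1 := Complex.Gamma_mul_Gamma_one_sub p
  have h2 := Complex.Gamma_add_one (-p) (neg_ne_zero.2 hp)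
  rw [neg_add_eq_sub] at h2
  rw [h2] at h1
  have h3 : Complex.Gamma p * Complex.Gamma (-p) = -(Real.pi / (p * Complex.sin (Real.pi * p))) := by
    rw [← div_div, div_right_comm, ← h1]
    field_simp
  rw [h3, sineFactor, inv_neg, inv_div]

theorem HasResidueAndFinitePart.meromorphicAt {f : ℂ → ℂ} {p r b : ℂ}
    (h : HasResidueAndFinitePart f p r b) : MeromorphicAt f p := by
  obtain ⟨k, hk, -, hf⟩ := h
  refine MeromorphicAt.congr (f := fun s => r / (s - p) + k s) ?_ (hf.mono fun s hs => hs.symm)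
  fun_prop

theorem hasResidue_of_analytic {f k : ℂ → ℂ} {p : ℂ} (hk : AnalyticAt ℂ k p)
    (h : f =ᶠ[𝓝[≠] p] k) : ∃ b, HasResidueAndFinitePart f p 0 b :=
  ⟨k p, k, hk, rfl, by filter_upwards [h] with s hs; rw [hs, zero_div, zero_add]⟩

theorem HasResidueAndFinitePart.exists_analytic {f : ℂ → ℂ} {p b : ℂ}
    (h : HasResidueAndFinitePart f p 0 b) : ∃ k, AnalyticAt ℂ k p ∧ f =ᶠ[𝓝[≠] p] k := by
  obtain ⟨k, hk, -, hf⟩ := h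
  exact ⟨k, hk, by filter_upwards [hf] with s hs; rw [hs, zero_div, zero_add]⟩

/-- The function with its removable singularities removed. -/
def removeSingularities (f : ℂ → ℂ) (s : ℂ) : ℂ := limUnder (𝓝[≠] s) f

theorem removeSingularities_eventuallyEq {f : ℂ → ℂ} {p : ℂ} (h : MeromorphicAt f p) :
    removeSingularities f =ᶠ[𝓝[≠] p] f := by
  filter_upwards [h.eventually_analyticAt] with s hs
  exact (hs.continuousAt.tendsto.mono_left nhdsWithin_le_nhds).limUnder_eq

/-- The formula for the continuation divides by zero where a formal pole is cancelled, so its value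
there is meaningless; the punctured limit restores the analytic value. -/
theorem removeSingularities_eventuallyEq_of_analytic {f k : ℂ → ℂ} {p : ℂ} (hk : AnalyticAt ℂ k p)
    (h : f =ᶠ[𝓝[≠] p] k) : removeSingularities f =ᶠ[𝓝 p] k := by
  have h1 := (removeSingularities_eventuallyEq (hk.meromorphicAt.congr h.symm)).trans h
  refine eventuallyEq_nhds_of_eventuallyEq_nhdsNE h1 ?_
  exact ((hk.continuousAt.tendsto.mono_left nhdsWithin_le_nhds).congr' h.symm).limUnder_eq

theorem principalPart_sum {ι : Type*} (F : Finset ι) (c₀ c₁ : ι → ℂ) (β : ι → ℂ) (p : ℂ) :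
    ∃ K : ℂ → ℂ, AnalyticAt ℂ K p ∧ ∀ s, ∑ j ∈ F, (c₀ j / (s - β j) + c₁ j / (s - β j) ^ 2) =
      K s + (∑ j ∈ F, if β j = p then c₀ j else 0) / (s - p) +
        (∑ j ∈ F, if β j = p then c₁ j else 0) / (s - p) ^ 2 := by
  refine ⟨fun s => ∑ j ∈ F, if β j = p then 0 else (c₀ j / (s - β j) + c₁ j / (s - β j) ^ 2),
    ?_, fun s => ?_⟩
  · refine Finset.analyticAt_fun_sum _ fun j _ => ?_
    split_ifs with h
    · exact analyticAt_const
    · have h1 : p - β j ≠ 0 := sub_ne_zero.2 (Ne.symm h)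
      have h2 : (p - β j) ^ 2 ≠ 0 := pow_ne_zero _ h1
      exact (analyticAt_const.div (analyticAt_id.sub analyticAt_const) h1).add
        (analyticAt_const.div ((analyticAt_id.sub analyticAt_const).pow 2) h2)
  · rw [Finset.sum_div, Finset.sum_div, ← Finset.sum_add_distrib, ← Finset.sum_add_distrib]
    refine Finset.sum_congr rfl fun j _ => ?_
    split_ifs with h
    · rw [h, zero_add]
    · simp

/-! ### The continuation and its principal parts -/

section

variable {S : ℕ → ℂ} {θ c : ℝ} {N : ℕ∞} {α : ℕ → ℝ} {a : ℕ → ℕ →₀ ℂ} {p : ℕ} {κ : ℂ}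

/-- After the terms `j ≤ M` the remainder is `O(x ^ β)`, and the later exponents do not exceed
`β`. -/
structure IsAdmissible (S : ℕ → ℂ) (N : ℕ∞) (α : ℕ → ℝ) (a : ℕ → ℕ →₀ ℂ) (M : ℕ) (β : ℝ) :
    Prop where
  le : (M : ℕ∞) ≤ N
  isBigO : axisRemainder S α a M =O[atTop] fun x : ℝ => x ^ β
  exponent_le : ∀ j : ℕ, (j : ℕ∞) ≤ N → M < j → α j ≤ β

/-- For `N = ∞` take `M` with `α M < r` and `β = α M`, since the exponents tend to `-∞`. For finite
`N` take the last index, with `β = α N`, or `β = α N - ε` under the stronger remainder bound. -/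
theorem IsTotallyRegular.exists_isAdmissible (hS : IsTotallyRegular S θ c N α a) {σ : EReal}
    (hσ : σ = order N α ∨ ∃ n : ℕ, N = (n : ℕ∞) ∧ ∃ ε : ℝ, 0 < ε ∧
      (remainder S α a n =O[atInfinity θ c] fun l : ℂ => ‖l‖ ^ (α n - ε)) ∧
        σ = ((α n - ε : ℝ) : EReal)) {r : ℝ} (hr : σ < ((r : ℝ) : EReal)) :
    ∃ M β, IsAdmissible S N α a M β ∧ β < r := by
  rcases hσ with rfl | ⟨n, rfl, ε, -, hO, rfl⟩
  · induction N using ENat.recTopCoe with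
    | top =>
      obtain ⟨M, hM⟩ := ((hS.exponents_atBot rfl).eventually_lt_atBot r).exists
      exact ⟨M, α M, ⟨le_top, (hS.isLittleO_axisRemainder le_top).isBigO,
        fun j hj hMj => (hS.exponents_lt M j hMj hj).le⟩, hM⟩
    | coe n =>
      have h1 : α n < r := by simpa [order] using hr
      exact ⟨n, α n, ⟨le_rfl, (hS.isLittleO_axisRemainder le_rfl).isBigO,
        fun j hj hMj => absurd (Nat.cast_le.1 hj) (not_le.2 hMj)⟩, h1⟩
  · exact ⟨n, α n - ε, ⟨le_rfl, hS.isBigO_axisRemainder le_rfl hO,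
      fun j hj hMj => absurd (Nat.cast_le.1 hj) (not_le.2 hMj)⟩, EReal.coe_lt_coe_iff.1 hr⟩

theorem IsSpectralType.mellinAux_eq_of_isAdmissible (hS : IsSpectralType S θ c N α a)
    {M M' : ℕ} {β β' : ℝ} (hM : IsAdmissible S N α a M β) (hM' : IsAdmissible S N α a M' β')
    {s : ℂ} (hβ : β < s.re) (hβ' : β' < s.re) :
    mellinAux S α a p κ M s = mellinAux S α a p κ M' s := by
  rcases le_total M M' with h | h
  · exact hS.mellinAux_eq_of_le p κ h hM'.isBigO hβ' fun j h1 h2 =>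
      (hM.exponent_le j ((Nat.cast_le.2 h2).trans hM'.le) h1).trans_lt hβ
  · exact (hS.mellinAux_eq_of_le p κ h hM.isBigO hβ fun j h1 h2 =>
      (hM'.exponent_le j ((Nat.cast_le.2 h2).trans hM.le) h1).trans_lt hβ').symm

open Classical in
/-- An index after which the remainder is small enough for the Mellin transform at `s`. -/
def truncation (S : ℕ → ℂ) (N : ℕ∞) (α : ℕ → ℝ) (a : ℕ → ℕ →₀ ℂ) (s : ℂ) : ℕ :=
  if h : ∃ M β, IsAdmissible S N α a M β ∧ β < s.re then h.choose else 0

open Classical in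
/-- The continuation of the zeta function, up to its values at removable singularities. -/
def zetaContinuation (S : ℕ → ℂ) (N : ℕ∞) (α : ℕ → ℝ) (a : ℕ → ℕ →₀ ℂ) (p : ℕ) (κ : ℂ) (s : ℂ) :
    ℂ :=
  if exponent S < ((s.re : ℝ) : EReal) then zetaSeries S s
  else sineFactor s * mellinAux S α a p κ (truncation S N α a s) s

theorem IsTotallyRegular.zetaContinuation_eq (hS : IsTotallyRegular S θ c N α a)
    (hp : IsRegDegree S p κ) {M : ℕ} {β : ℝ} (hM : IsAdmissible S N α a M β) {s : ℂ}
    (hβ : β < s.re) (hs : s.re < p + 1) :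
    zetaContinuation S N α a p κ s = sineFactor s * mellinAux S α a p κ M s := by
  by_cases he : exponent S < ((s.re : ℝ) : EReal)
  · have hps : (p : ℝ) < s.re := EReal.coe_lt_coe_iff.1 (hp.le_exponent.trans_lt he)
    have hs0 : s ≠ 0 := fun h => by
      rw [h, Complex.zero_re] at hps
      exact absurd hps (not_lt.2 (Nat.cast_nonneg p))
    have hpi : (Real.pi : ℂ) ≠ 0 := Complex.ofReal_ne_zero.2 Real.pi_ne_zero
    -- Here `p < Re s < p + 1`, so `s` is not an integer and the Mellin identity can be solved for
    -- the series.
    have hsin : Complex.sin (Real.pi * s) ≠ 0 := by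
      rw [Ne, Complex.sin_eq_zero_iff]
      rintro ⟨k, hk⟩
      have h1 : s = k := mul_left_cancel₀ hpi (by rw [hk, mul_comm])
      rw [h1, Complex.intCast_re] at hps hs
      have h2 : (p : ℤ) < k := by exact_mod_cast hps
      have h3 : k < (p : ℤ) + 1 := by exact_mod_cast hs
      omega
    rw [zetaContinuation, if_pos he, hS.mellinAux_eq hp hM.le hM.isBigO hβ he hs, sineFactor]
    rw [mul_neg, neg_mul, neg_neg]
    generalize Complex.sin (Real.pi * s) = w at hsin ⊢
    field_simp
  · have hex : ∃ M β, IsAdmissible S N α a M β ∧ β < s.re := ⟨M, β, hM, hβ⟩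
    obtain ⟨β', hM', hβ'⟩ := hex.choose_spec
    have ht : truncation S N α a s = hex.choose := by rw [truncation, dif_pos hex]
    rw [zetaContinuation, if_neg he, ht,
      hS.mellinAux_eq_of_isAdmissible hM' hM hβ' hβ]

/-- The principal part at `q` of the Mellin transform of the regularized `log Γ`. -/
theorem IsTotallyRegular.zetaContinuation_local (hS : IsTotallyRegular S θ c N α a)
    (hp : IsRegDegree S p κ) {M : ℕ} {β : ℝ} (hM : IsAdmissible S N α a M β) {q : ℂ}
    (hβ : β < q.re) (hq : q.re < p + 1) :
    ∃ K : ℂ → ℂ, AnalyticAt ℂ K q ∧ ∀ᶠ s in 𝓝 q, zetaContinuation S N α a p κ s =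
      sineFactor s * (K s +
        ((if (((genus S : ℝ) + 1 : ℝ) : ℂ) = q then κ else 0) +
          ∑ j ∈ Finset.range (M + 1), if (α j : ℂ) = q then a j 0 else 0) / (s - q) +
        (∑ j ∈ Finset.range (M + 1), if (α j : ℂ) = q then a j 1 else 0) / (s - q) ^ 2) := by
  have hs1 : Summable fun n => ‖S n‖ ^ (-((p : ℝ) + 1)) :=
    summable_norm_rpow hS.tendsto_norm hp.exponent_lt
  obtain ⟨K₁, hK₁, hK₁'⟩ := principalPart_sum (Finset.range (M + 1)) (fun j => a j 0)
    (fun j => a j 1) (fun j => (α j : ℂ)) q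
  obtain ⟨K₂, hK₂, hK₂'⟩ := principalPart_sum {()} (fun _ => κ) (fun _ => 0)
    (fun _ => (((genus S : ℝ) + 1 : ℝ) : ℂ)) q
  simp only [Finset.sum_singleton, zero_div, add_zero, ite_self] at hK₂'
  refine ⟨fun s => headMellin (regLogGamma S p) s + K₂ s +
    (tailMellin (axisRemainder S α a M) s + K₁ s), ?_, ?_⟩
  · refine ((analyticAt_headMellin (continuousOn_regLogGamma hS.re_pos hs1)
      (isBigO_regLogGamma hS.re_pos (by linarith) le_rfl hs1 self_mem_nhdsWithin) hq).add hK₂).add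
      ((analyticAt_tailMellin (hS.continuousOn_axisRemainder M) hM.isBigO hβ).add hK₁)
  · have h1 : {s : ℂ | β < s.re} ∈ 𝓝 q :=
      (isOpen_lt continuous_const Complex.continuous_re).mem_nhds hβ
    have h2 : {s : ℂ | s.re < p + 1} ∈ 𝓝 q :=
      (isOpen_lt Complex.continuous_re continuous_const).mem_nhds hq
    filter_upwards [h1, h2] with s hs1 hs2
    rw [hS.zetaContinuation_eq hp hM hs1 hs2, mellinAux, hK₁', hK₂']
    ring

theorem zetaContinuation_eventuallyEq {q : ℂ} (hq : exponent S < ((q.re : ℝ) : EReal)) :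
    zetaContinuation S N α a p κ =ᶠ[𝓝 q] zetaSeries S := by
  obtain ⟨r, hr1, hr2⟩ := EReal.lt_iff_exists_real_btwn.1 hq
  have h1 : {s : ℂ | r < s.re} ∈ 𝓝 q :=
    (isOpen_lt continuous_const Complex.continuous_re).mem_nhds (EReal.coe_lt_coe_iff.1 hr2)
  filter_upwards [h1] with s hs
  rw [zetaContinuation, if_pos (hr1.trans (EReal.coe_lt_coe_iff.2 hs))]

theorem IsSpectralType.analyticAt_zetaSeries (hS : IsSpectralType S θ c N α a) {q : ℂ}
    (hq : exponent S < ((q.re : ℝ) : EReal)) : AnalyticAt ℂ (zetaSeries S) q :=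
  SpectralSeq.analyticAt_zetaSeries hS.ne_zero hS.tendsto_norm hq

/-- Off the exponents, the singularities of the continuation are removable. -/
theorem IsTotallyRegular.exists_analytic (hS : IsTotallyRegular S θ c N α a)
    (hp : IsRegDegree S p κ) {M : ℕ} {β : ℝ} (hM : IsAdmissible S N α a M β) {q : ℂ}
    (hβ : β < q.re) (hq : ∀ j : ℕ, (j : ℕ∞) ≤ N → q ≠ (α j : ℂ)) :
    ∃ k, AnalyticAt ℂ k q ∧ zetaContinuation S N α a p κ =ᶠ[𝓝[≠] q] k := by
  rcases le_or_gt ((p : ℝ) + 1) q.re with h | h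
  · have hq' : exponent S < ((q.re : ℝ) : EReal) :=
      hp.exponent_lt.trans_le (EReal.coe_le_coe_iff.2 h)
    exact ⟨_, hS.analyticAt_zetaSeries hq',
      (zetaContinuation_eventuallyEq hq').filter_mono nhdsWithin_le_nhds⟩
  · obtain ⟨K, hK, hloc⟩ := hS.zetaContinuation_local hp hM hβ h
    have hzero : ∀ j ∈ Finset.range (M + 1), ¬ (α j : ℂ) = q := fun j hj h1 =>
      hq j ((Nat.cast_le.2 (Nat.lt_succ_iff.1 (Finset.mem_range.1 hj))).trans hM.le) h1.symm
    rw [Finset.sum_congr rfl fun j hj => if_neg (hzero j hj),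
      Finset.sum_congr rfl fun j hj => if_neg (hzero j hj), Finset.sum_const_zero, add_zero] at hloc
    have hloc' := hloc.filter_mono (nhdsWithin_le_nhds (s := {q}ᶜ))
    -- The only formal pole left is that of the correction `κ` at the integer `g + 1`, and the sine
    -- factor cancels it.
    by_cases hg : (((genus S : ℝ) + 1 : ℝ) : ℂ) = q
    · have hg' : q = ((genus S + 1 : ℤ) : ℂ) := by rw [← hg]; push_cast; rfl
      subst hg'
      have h1 := hasResidue_sineFactor_mul_int hK hloc'
      rw [mul_zero] at h1
      exact h1.exists_analytic
    · rw [if_neg hg] at hloc'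
      obtain ⟨b, hb⟩ := hasResidue_sineFactor_mul (c₁ := 0) hK (by simpa [EventuallyEq] using hloc')
      rw [mul_zero] at hb
      exact hb.exists_analytic

theorem IsTotallyRegular.zetaContinuation_at_exponent (hS : IsTotallyRegular S θ c N α a)
    (hp : IsRegDegree S p κ) {M : ℕ} {β : ℝ} (hM : IsAdmissible S N α a M β) {j : ℕ}
    (hj : (j : ℕ∞) ≤ N) (hβ : β < α j) (hα : α j < p + 1) :
    ∃ K : ℂ → ℂ, AnalyticAt ℂ K (α j) ∧ ∀ᶠ s in 𝓝[≠] (α j : ℂ), zetaContinuation S N α a p κ s =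
      sineFactor s * (K s + ((if α j = (genus S : ℝ) + 1 then κ else 0) + a j 0) / (s - α j) +
        a j 1 / (s - α j) ^ 2) := by
  obtain ⟨K, hK, hloc⟩ := hS.zetaContinuation_local hp hM (q := α j) (by simpa using hβ)
    (by simpa using hα)
  refine ⟨K, hK, ?_⟩
  have hjM : j ∈ Finset.range (M + 1) := by
    by_contra h
    have h1 : M < j := by
      rw [Finset.mem_range] at h
      omega
    exact absurd (hM.exponent_le j hj h1) (not_le.2 hβ)
  -- The exponents are distinct, so only the `j`-th term of the expansion has its pole at `α j`.
  have hinj : ∀ i ∈ Finset.range (M + 1), i ≠ j → ¬ (α i : ℂ) = α j := by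
    intro i hi hij h
    have hiN : (i : ℕ∞) ≤ N :=
      (Nat.cast_le.2 (Nat.lt_succ_iff.1 (Finset.mem_range.1 hi))).trans hM.le
    have h1 := Complex.ofReal_injective h
    rcases lt_or_gt_of_ne hij with h2 | h2
    · exact (hS.exponents_lt i j h2 hj).ne' h1
    · exact (hS.exponents_lt j i h2 hiN).ne h1
  rw [Finset.sum_eq_single_of_mem j hjM fun i hi hij => if_neg (hinj i hi hij),
    Finset.sum_eq_single_of_mem j hjM fun i hi hij => if_neg (hinj i hi hij)] at hloc
  simp only [if_true, Complex.ofReal_inj, eq_comm (b := α j)] at hloc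
  exact hloc.filter_mono nhdsWithin_le_nhds

/-- If `α j ≥ p + 1`, the coefficients vanish and the series is analytic. At an integer above the
genus there is no logarithmic term, and the sine cancels the simple pole, including that of `κ`. At
a non-integer neither a logarithm nor `κ` is present, and the residue is `a j 0` times the value of
the sine factor. -/
theorem IsTotallyRegular.hasResidue_nonint (hS : IsTotallyRegular S θ c N α a)
    (hp : IsRegDegree S p κ) {M : ℕ} {β : ℝ} (hM : IsAdmissible S N α a M β) {j : ℕ}
    (hj : (j : ℕ∞) ≤ N) (hβ : β < α j) (hm : ∀ m : ℤ, α j = m → (genus S : ℤ) < m) :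
    ∃ b : ℂ, HasResidueAndFinitePart (zetaContinuation S N α a p κ) (α j)
      (a j 0 / (Complex.Gamma (α j) * Complex.Gamma (-(α j : ℂ)))) b := by
  -- `Complex.Gamma` is `0` at its poles, so the quotient by the product of Gammas is `0`, in
  -- accordance with the convention `1/Γ = 0`.
  have hGamma : ∀ m : ℤ, α j = m → Complex.Gamma (-(α j : ℂ)) = 0 := fun m h => by
    have h1 := hm m h
    obtain ⟨k, rfl⟩ := Int.eq_ofNat_of_zero_le (show 0 ≤ m by omega)
    rw [h, Int.cast_natCast, Complex.ofReal_natCast]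
    exact Complex.Gamma_neg_nat_eq_zero k
  rcases le_or_gt ((p : ℝ) + 1) (α j) with h | h
  · have hq' : exponent S < ((α j : ℝ) : EReal) :=
      hp.exponent_lt.trans_le (EReal.coe_le_coe_iff.2 h)
    have h0 := (hS.coeffs_eq_zero_of_exponent_lt hp hj hq').1
    have hq'' : exponent S < (((α j : ℂ).re : ℝ) : EReal) := by simpa using hq'
    rw [h0, zero_div]
    exact hasResidue_of_analytic (hS.analyticAt_zetaSeries hq'')
      ((zetaContinuation_eventuallyEq hq'').filter_mono nhdsWithin_le_nhds)
  · obtain ⟨K, hK, hloc⟩ := hS.zetaContinuation_at_exponent hp hM hj hβ h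
    by_cases hint : ∃ m : ℤ, α j = m
    · obtain ⟨m, hmα⟩ := hint
      have h1 : (genus S : ℝ) + 1 ≤ α j := by
        rw [hmα]
        exact_mod_cast hm m hmα
      have h2 : (α j : ℂ) = (m : ℂ) := by rw [hmα]; simp
      rw [hGamma m hmα, mul_zero, div_zero]
      rw [hS.log_coeff_eq_zero_of_genus_lt hj h1, h2] at hloc
      rw [h2] at hK ⊢
      have h3 := hasResidue_sineFactor_mul_int hK hloc
      rw [mul_zero] at h3
      exact ⟨_, h3⟩
    · have h1 : a j 1 = 0 := by
        by_contra h0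
        obtain ⟨m, hmα⟩ := hS.exponent_of_log j hj h0
        exact hint ⟨m, by simpa using hmα⟩
      have h2 : ¬ α j = (genus S : ℝ) + 1 := fun h0 => hint ⟨genus S + 1, by simpa using h0⟩
      rw [h1, if_neg h2] at hloc
      obtain ⟨b, hb⟩ := hasResidue_sineFactor_mul (c₁ := a j 0) hK (by simpa [EventuallyEq] using hloc)
      rw [sineFactor_eq_inv_Gamma fun m h0 => hint ⟨m, by exact_mod_cast h0⟩, mul_comm,
        ← div_eq_mul_inv] at hb
      exact ⟨b, hb⟩

theorem IsTotallyRegular.hasResidue_int (hS : IsTotallyRegular S θ c N α a)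
    (hp : IsRegDegree S p κ) {M : ℕ} {β : ℝ} (hM : IsAdmissible S N α a M β) {j : ℕ}
    (hj : (j : ℕ∞) ≤ N) (hβ : β < α j) {m : ℤ} (hmα : α j = m) (hm : m ≤ (genus S : ℤ)) :
    HasResidueAndFinitePart (zetaContinuation S N α a p κ) (α j)
      ((-1) ^ (m + 1) * (m : ℂ) * a j 1) ((-1) ^ (m + 1) * ((m : ℂ) * a j 0 + a j 1)) := by
  -- Being below `g + 1`, the exponent does not meet the correction `κ` and lies in the half-plane
  -- `Re s < p + 1` where the local formula holds.
  have h1 : α j < (genus S : ℝ) + 1 := by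
    rw [hmα]
    exact_mod_cast Int.lt_add_one_of_le hm
  have h2 : (genus S : ℝ) ≤ p := by exact_mod_cast hp.genus_le
  have h3 : (α j : ℂ) = (m : ℂ) := by rw [hmα]; simp
  obtain ⟨K, hK, hloc⟩ := hS.zetaContinuation_at_exponent hp hM hj hβ (by linarith)
  rw [if_neg h1.ne, zero_add, h3] at hloc
  rw [h3] at hK ⊢
  exact hasResidue_sineFactor_mul_int hK hloc

end

end SpectralSeq

end

/-! ### Assembly of the theorem -/

theorem mainTheorem7 (S : ℕ → ℂ) (θ c : ℝ) (N : ℕ∞) (α : ℕ → ℝ) (a : ℕ → ℕ →₀ ℂ)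
    (hS : SpectralSeq.IsTotallyRegular S θ c N α a) (σ : EReal)
    (hσ : σ = SpectralSeq.order N α ∨
      ∃ n : ℕ, N = (n : ℕ∞) ∧ ∃ ε : ℝ, 0 < ε ∧
        (SpectralSeq.remainder S α a n =O[SpectralSeq.atInfinity θ c]
          fun l : ℂ => ‖l‖ ^ (α n - ε)) ∧
        σ = ((α n - ε : ℝ) : EReal)) :
    ∃ Z : ℂ → ℂ,
      (∀ s : ℂ, SpectralSeq.exponent S < ((s.re : ℝ) : EReal) →
        HasSum (fun n : ℕ => S n ^ (-s)) (Z s)) ∧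
      MeromorphicOn Z {s : ℂ | σ < ((s.re : ℝ) : EReal)} ∧
      AnalyticOnNhd ℂ Z
        {s : ℂ | σ < ((s.re : ℝ) : EReal) ∧ ∀ j : ℕ, (j : ℕ∞) ≤ N → s ≠ ((α j : ℝ) : ℂ)} ∧
      ∀ j : ℕ, (j : ℕ∞) ≤ N → σ < ((α j : ℝ) : EReal) →
        ((∀ m : ℤ, α j = m → (SpectralSeq.genus S : ℤ) < m) →
          ∃ b : ℂ, SpectralSeq.HasResidueAndFinitePart Z (α j)
            (a j 0 / (Complex.Gamma (α j) * Complex.Gamma (-(α j : ℂ)))) b) ∧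
        (∀ m : ℤ, α j = m → 1 ≤ m → m ≤ (SpectralSeq.genus S : ℤ) →
          SpectralSeq.HasResidueAndFinitePart Z (α j)
            ((-1) ^ (m + 1) * (m : ℂ) * a j 1)
            ((-1) ^ (m + 1) * ((m : ℂ) * a j 0 + a j 1))) ∧
        (α j = 0 →
          SpectralSeq.HasResidueAndFinitePart Z (α j) 0 (-(a j 1))) ∧
        (∀ m : ℤ, α j = m → m ≤ -1 →
          SpectralSeq.HasResidueAndFinitePart Z (α j) 0
            ((-1) ^ (m + 1) * (m : ℂ) * a j 0)) := by
  obtain ⟨p, κ, hp⟩ := hS.exists_isRegDegree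
  set Z₀ := SpectralSeq.zetaContinuation S N α a p κ with hZ₀
  have transfer : ∀ {q r b : ℂ}, SpectralSeq.HasResidueAndFinitePart Z₀ q r b →
      SpectralSeq.HasResidueAndFinitePart (SpectralSeq.removeSingularities Z₀) q r b :=
    fun h => h.congr (SpectralSeq.removeSingularities_eventuallyEq h.meromorphicAt)
  have hint : ∀ j : ℕ, (j : ℕ∞) ≤ N → σ < ((α j : ℝ) : EReal) → ∀ m : ℤ, α j = m →
      m ≤ (SpectralSeq.genus S : ℤ) →
      SpectralSeq.HasResidueAndFinitePart (SpectralSeq.removeSingularities Z₀) (α j)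
        ((-1) ^ (m + 1) * (m : ℂ) * a j 1)
        ((-1) ^ (m + 1) * ((m : ℂ) * a j 0 + a j 1)) := by
    intro j hj hαj m hm hmg
    obtain ⟨M, β, hM, hβ⟩ := hS.exists_isAdmissible hσ hαj
    exact transfer (hS.hasResidue_int hp hM hj hβ hm hmg)
  have hana : ∀ s : ℂ, σ < ((s.re : ℝ) : EReal) →
      (∀ j : ℕ, (j : ℕ∞) ≤ N → s ≠ ((α j : ℝ) : ℂ)) →
      AnalyticAt ℂ (SpectralSeq.removeSingularities Z₀) s := by
    intro s hs hne
    obtain ⟨M, β, hM, hβ⟩ := hS.exists_isAdmissible hσ hs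
    obtain ⟨k, hk, hZk⟩ := hS.exists_analytic hp hM hβ hne
    exact hk.congr (SpectralSeq.removeSingularities_eventuallyEq_of_analytic hk hZk).symm
  have hnon : ∀ j : ℕ, (j : ℕ∞) ≤ N → σ < ((α j : ℝ) : EReal) →
      (∀ m : ℤ, α j = m → (SpectralSeq.genus S : ℤ) < m) →
      ∃ b : ℂ, SpectralSeq.HasResidueAndFinitePart (SpectralSeq.removeSingularities Z₀) (α j)
        (a j 0 / (Complex.Gamma (α j) * Complex.Gamma (-(α j : ℂ)))) b := by
    intro j hj hαj hm
    obtain ⟨M, β, hM, hβ⟩ := hS.exists_isAdmissible hσ hαj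
    obtain ⟨b, hb⟩ := hS.hasResidue_nonint hp hM hj hβ hm
    exact ⟨b, transfer hb⟩
  refine ⟨SpectralSeq.removeSingularities Z₀, fun s hs => ?_, fun s hs => ?_,
    fun s hs => hana s hs.1 hs.2, fun j hj hαj => ⟨hnon j hj hαj,
      fun m hm _ hmg => hint j hj hαj m hm hmg, fun h0 => ?_, fun m hm hm1 => ?_⟩⟩
  · have h1 := SpectralSeq.removeSingularities_eventuallyEq_of_analytic
      (hS.analyticAt_zetaSeries hs) ((SpectralSeq.zetaContinuation_eventuallyEq
        (N := N) (α := α) (a := a) (p := p) (κ := κ) hs).filter_mono nhdsWithin_le_nhds)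
    rw [h1.self_of_nhds]
    exact (SpectralSeq.summable_cpow_neg hS.ne_zero
      (SpectralSeq.summable_norm_rpow hS.tendsto_norm hs)).hasSum
  · by_cases hne : ∀ j : ℕ, (j : ℕ∞) ≤ N → s ≠ ((α j : ℝ) : ℂ)
    · exact (hana s hs hne).meromorphicAt
    · push Not at hne
      obtain ⟨j, hj, rfl⟩ := hne
      have hαj : σ < ((α j : ℝ) : EReal) := by simpa using hs
      by_cases hm : ∀ m : ℤ, α j = m → (SpectralSeq.genus S : ℤ) < m
      · obtain ⟨b, hb⟩ := hnon j hj hαj hm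
        exact hb.meromorphicAt
      · push Not at hm
        obtain ⟨m, hm, hmg⟩ := hm
        exact (hint j hj hαj m hm hmg).meromorphicAt
  -- At `0` the sine factor has a double zero: with `m = 0` the residue vanishes and only `-a j 1`
  -- survives in the finite part.
  · simpa using hint j hj hαj 0 (by simpa using h0) (by simp)
  -- Total regularity allows logarithms only at nonnegative integer exponents.
  · have ha : a j 1 = 0 := by
      by_contra h0
      obtain ⟨k, hk⟩ := hS.exponent_of_log j hj h0
      have h1 : (m : ℝ) = ((k : ℤ) : ℝ) := by rw [← hm, hk]; simp
      have h2 : m = (k : ℤ) := by exact_mod_cast h1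
      omega
    simpa [ha, mul_assoc] using hint j hj hαj m hm (by omega)
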